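/- Fix $T>0$ and put $I_T=[0,T]$. Let $X$ be the set of sequences $a=(a_1,a_2,\dots)$ of bounded measurable functions $a_i:I_T\to\mathbb C$ with $\sup_{x\in I_T,\,i\ge 1}|a_i(x)|^{1/i}<\infty$. Consider the equation $$\frac{dv}{dx}=\sum_{i=1}^{\infty}a_i(x)\,v^{i+1},\qquad x\in I_T, \tag{1}$$ and let $\mathcal C\subset X$ be the set of *centers*: those $a$ for which every (Lipschitz, complex-valued) solution $v$ of (1) on $I_T$ with sufficiently small initial value $v(0)$ satisfies $v(T)=v(0)$. For $a,b\in X$ define $a*b$ and $a^{-1}$ by $(a*b)_i(x)=2b_i(2x)$ for $0\le x\le T/2$, $(a*b)_i(x)=2a_i(2x-T)$ for $T/2<x\le T$, and $(a^{-1})_i(x)=-a_i(T-x)$. The basic iterated integrals are $$I_{i_1,\dots,i_k}(a)=\int\cdots\int_{0\le s_1\le\cdots\le s_k\le T}a_{i_k}(s_k)\cdots a_{i_1}(s_1)\,ds_k\cdots ds_1 \qquad (k\ge 1),$$ and $I_\emptyset=1$. Write $a\sim b$ if all basic iterated integrals of order $k\ge1$ vanish at $a*b^{-1}$; this is an equivalence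 relation, the set $G(X)$ of its classes is a group under the product induced by $*$, and $\pi:X\to G(X)$ denotes the quotient map. The iterated integrals descend to functions $\widehat I_{i_1,\dots,i_k}$ on $G(X)$. Equip $G(X)$ with the metric $$d(g,h)=\sum_{n=1}^{\infty}\frac1{4^n}\sum_{i_1+\cdots+i_k=n}\frac{|\widehat I_{i_1,\dots,i_k}(g)-\widehat I_{i_1,\dots,i_k}(h)|}{1+|\widehat I_{i_1,\dots,i_k}(g)-\widehat I_{i_1,\dots,i_k}(h)|},$$ and let $G_f(X)$ (the *group of formal paths*) be the completion of $(G(X),d)$, a topological group whose product and inversion extend those of $G(X)$ by continuity. Extend the functions $\widehat I_{i_1,\dots,i_k}$ to $G_f(X)$ by continuity. Let $G[[r]]$ be the group of formal power series $r+\sum_{i\ge1}d_ir^{i+1}$, $d_i\in\mathbb C$, under composition, and let $\widehat P:G_f(X)\to G[[r]]$ be the homomorphism (the extension of the first return map of (1)) $$\widehat P(g)=r+\sum_{i=1}^\infty\Bigl(\sum_{i_1+\cdots+i_k=i}p_{i_1,\dots,i_k}(i)\,\widehat I_{i_1,\dots,i_k}(g)\Bigr)r^{i+1},$$ $$p_{i_1,\dots,i_k}(t)=(t-i_1+1)(t-i_1-i_2+1)\cdots(t-i_1-\cdots-i_k+1).$$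 The *group of formal centers* is $\widehat{\mathcal C}_f=\operatorname{Ker}\widehat P\subset G_f(X)$, and the *group of centers* is $\widehat{\mathcal C}=\pi(\mathcal C)\subset G(X)\subset G_f(X)$. **Proposition.** $\widehat{\mathcal C}$ is a subgroup of $G(X)$; it is contained in $\widehat{\mathcal C}_f$, and it is dense in $\widehat{\mathcal C}_f$. -/

import Mathlib

noncomputable section

namespace CenterProblem

open MeasureTheory Set Filter Topology
open scoped Interval

/-! ### Coefficient sequences and their product -/

/-- The set `X` of sequences `a = (a₁, a₂, …)` of bounded measurable functions on `[0, T]` with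
`sup_{x, i} |aᵢ(x)|^{1/i} < ∞`. A function on `[0, T]` is recorded as the function on `ℝ` that
extends it by zero. -/
structure CoeffSeq (T : ℝ) where
  fn : ℕ+ → ℝ → ℂ
  measurable_coeff : ∀ i, Measurable (fn i)
  support_coeff : ∀ i x, x ∉ Icc 0 T → fn i x = 0
  bound_coeff : ∃ C : ℝ, ∀ i x, ‖fn i x‖ ^ ((i : ℝ)⁻¹) ≤ C

namespace CoeffSeq

variable {T : ℝ}

/-- The product `a * b` (the path of `b` followed by the path of `a`). -/
def mul (a b : CoeffSeq T) : CoeffSeq T where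
  fn i x := if x ≤ T / 2 then 2 * b.fn i (2 * x) else 2 * a.fn i (2 * x - T)
  measurable_coeff i := by
    refine Measurable.ite measurableSet_Iic ?_ ?_
    · exact ((b.measurable_coeff i).comp (measurable_const_mul 2)).const_mul 2
    · exact ((a.measurable_coeff i).comp ((measurable_const_mul 2).sub_const T)).const_mul 2
  support_coeff i x hx := by
    split_ifs with h
    · rw [b.support_coeff i, mul_zero]
      intro hh
      exact hx ⟨by linarith [hh.1], by linarith [hh.1, hh.2]⟩
    · rw [a.support_coeff i, mul_zero]
      intro hh
      exact hx ⟨by linarith [hh.1, hh.2], by linarith [hh.2]⟩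
  bound_coeff := by
    obtain ⟨A, hA⟩ := a.bound_coeff
    obtain ⟨B, hB⟩ := b.bound_coeff
    have key : ∀ (i : ℕ+) (z : ℂ), ‖2 * z‖ ^ ((i : ℝ)⁻¹) ≤ 2 * ‖z‖ ^ ((i : ℝ)⁻¹) := by
      intro i z
      rw [norm_mul, Real.mul_rpow (norm_nonneg _) (norm_nonneg _)]
      gcongr
      have h1 : (1 : ℝ) ≤ (i : ℝ) := by exact_mod_cast one_le
      calc ‖(2 : ℂ)‖ ^ ((i : ℝ)⁻¹) ≤ (2 : ℝ) ^ (1 : ℝ) := by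
            simp only [Complex.norm_ofNat]
            exact Real.rpow_le_rpow_of_exponent_le (by norm_num) (inv_le_one_of_one_le₀ h1)
        _ = 2 := Real.rpow_one 2
    refine ⟨max (2 * A) (2 * B), fun i x => ?_⟩
    split_ifs
    · exact (key i _).trans (le_max_of_le_right (by linarith [hB i (2 * x)]))
    · exact (key i _).trans (le_max_of_le_left (by linarith [hA i (2 * x - T)]))

/-- The inverse `a⁻¹` (the path of `a` with the opposite orientation). -/
def inv (a : CoeffSeq T) : CoeffSeq T where
  fn i x := -a.fn i (T - x)
  measurable_coeff i := ((a.measurable_coeff i).comp (measurable_const.sub measurable_id)).neg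
  support_coeff i x hx := by
    rw [a.support_coeff i, neg_zero]
    intro hh
    exact hx ⟨by linarith [hh.2], by linarith [hh.1]⟩
  bound_coeff := by
    obtain ⟨A, hA⟩ := a.bound_coeff
    exact ⟨A, fun i x => by rw [norm_neg]; exact hA i _⟩

/-- The sequence `(0, 0, …)`. -/
def zero : CoeffSeq T where
  fn _ _ := 0
  measurable_coeff _ := measurable_const
  support_coeff _ _ _ := rfl
  bound_coeff := ⟨0, fun i x => by
    have h1 : (i : ℝ)⁻¹ ≠ 0 := inv_ne_zero (by exact_mod_cast i.ne_zero)
    rw [norm_zero, Real.zero_rpow h1]⟩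

/-! ### Iterated integrals -/

/-- `iterFrom T a [i₁, …, iₖ] s` is the iterated integral of
`a_{iₖ}(sₖ) ⋯ a_{i₁}(s₁) dsₖ ⋯ ds₁` over `s ≤ s₁ ≤ ⋯ ≤ sₖ ≤ T`. -/
def iterFrom (T : ℝ) (a : ℕ+ → ℝ → ℂ) : List ℕ+ → ℝ → ℂ
  | [], _ => 1
  | i :: w, s => ∫ u in s..T, a i u * iterFrom T a w u

/-- The basic iterated integral `I_{i₁, …, iₖ}(a)` over `0 ≤ s₁ ≤ ⋯ ≤ sₖ ≤ T`. -/
def iterInt (a : CoeffSeq T) (w : List ℕ+) : ℂ := iterFrom T a.fn w 0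

lemma exists_norm_le (a : CoeffSeq T) (i : ℕ+) : ∃ C : ℝ, ∀ x, ‖a.fn i x‖ ≤ C := by
  obtain ⟨C, hC⟩ := a.bound_coeff
  refine ⟨C ^ (i : ℕ), fun x => ?_⟩
  have h := pow_le_pow_left₀ (by positivity) (hC i x) (i : ℕ)
  rwa [Real.rpow_inv_natCast_pow (norm_nonneg _) i.ne_zero] at h

lemma integrable_coeff (a : CoeffSeq T) (i : ℕ+) : Integrable (a.fn i) := by
  obtain ⟨C, hC⟩ := a.exists_norm_le i
  have h : IntegrableOn (a.fn i) (Icc 0 T) :=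
    Measure.integrableOn_of_bounded (M := C) (by simp)
      (a.measurable_coeff i).aestronglyMeasurable (Eventually.of_forall hC)
  exact h.integrable_of_forall_notMem_eq_zero (fun x hx => a.support_coeff i x hx)

lemma continuous_iterFrom (a : CoeffSeq T) (w : List ℕ+) :
    Continuous (iterFrom T a.fn w) := by
  induction w with
  | nil => exact continuous_const
  | cons i w ih =>
    have h : ∀ s t : ℝ, IntervalIntegrable (fun u => a.fn i u * iterFrom T a.fn w u)
        volume s t := fun s t =>
      (a.integrable_coeff i).intervalIntegrable.mul_continuousOn ih.continuousOn
    have h2 := (intervalIntegral.continuous_primitive h T).neg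
    convert h2 using 1
    ext s
    exact intervalIntegral.integral_symm _ _

lemma intervalIntegrable_iter (a : CoeffSeq T) (i : ℕ+) (w : List ℕ+) (s t : ℝ) :
    IntervalIntegrable (fun u => a.fn i u * iterFrom T a.fn w u) volume s t :=
  (a.integrable_coeff i).intervalIntegrable.mul_continuousOn
    (a.continuous_iterFrom w).continuousOn

@[simp] lemma iterInt_nil (a : CoeffSeq T) : a.iterInt [] = 1 := rfl

end CoeffSeq

/-! ### Concatenation product of functions on words -/

/-- `(f ⋆ g)(w) = ∑ f(u) g(v)` over all splittings `w = u ++ v`. -/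
def conv (f g : List ℕ+ → ℂ) : List ℕ+ → ℂ
  | [] => f [] * g []
  | i :: w => f [] * g (i :: w) + conv (fun u => f (i :: u)) g w
termination_by structural w => w


/-- The unit for `conv`. -/
def unitSeries : List ℕ+ → ℂ
  | [] => 1
  | _ :: _ => 0

lemma conv_nil (f g : List ℕ+ → ℂ) : conv f g [] = f [] * g [] := rfl

lemma conv_cons (f g : List ℕ+ → ℂ) (i : ℕ+) (w : List ℕ+) :
    conv f g (i :: w) = f [] * g (i :: w) + conv (fun u => f (i :: u)) g w := rfl

lemma conv_add_left (f₁ f₂ g : List ℕ+ → ℂ) (w : List ℕ+) :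
    conv (fun u => f₁ u + f₂ u) g w = conv f₁ g w + conv f₂ g w := by
  induction w generalizing f₁ f₂ with
  | nil => simp [conv_nil, add_mul]
  | cons i w ih => simp only [conv_cons, ih]; ring

lemma conv_smul_left (c : ℂ) (f g : List ℕ+ → ℂ) (w : List ℕ+) :
    conv (fun u => c * f u) g w = c * conv f g w := by
  induction w generalizing f with
  | nil => simp [conv_nil, mul_assoc]
  | cons i w ih => simp only [conv_cons, ih]; ring

lemma conv_zero_left (g : List ℕ+ → ℂ) (w : List ℕ+) :
    conv (fun _ => 0) g w = 0 := by
  induction w with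
  | nil => simp [conv_nil]
  | cons i w ih => simp only [conv_cons, ih]; ring

lemma unit_conv (g : List ℕ+ → ℂ) : conv unitSeries g = g := by
  ext w
  cases w with
  | nil => simp [conv_nil, unitSeries]
  | cons i w =>
    have h : (fun u => unitSeries (i :: u)) = fun _ => (0 : ℂ) := rfl
    rw [conv_cons, h, conv_zero_left]
    simp [unitSeries]

lemma conv_unit (f : List ℕ+ → ℂ) : conv f unitSeries = f := by
  ext w
  induction w generalizing f with
  | nil => simp [conv_nil, unitSeries]
  | cons i w ih => rw [conv_cons, ih]; simp [unitSeries]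

lemma conv_assoc (f g h : List ℕ+ → ℂ) : conv (conv f g) h = conv f (conv g h) := by
  ext w
  induction w generalizing f with
  | nil => simp [conv_nil, mul_assoc]
  | cons i w ih =>
    have e : (fun u => conv f g (i :: u))
        = fun u => f [] * g (i :: u) + conv (fun u => f (i :: u)) g u := rfl
    rw [conv_cons, conv_cons, e, conv_add_left (fun u => f [] * g (i :: u)), conv_smul_left, ih,
      conv_nil, conv_cons]
    ring

lemma continuous_conv : Continuous fun p : (List ℕ+ → ℂ) × (List ℕ+ → ℂ) => conv p.1 p.2 := by
  refine continuous_pi fun w => ?_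
  have : ∀ F : (List ℕ+ → ℂ) × (List ℕ+ → ℂ) → (List ℕ+ → ℂ), Continuous F →
      Continuous fun p => conv (F p) p.2 w := by
    induction w with
    | nil =>
      intro F hF
      exact ((continuous_apply _).comp hF).mul ((continuous_apply _).comp continuous_snd)
    | cons i w ih =>
      intro F hF
      refine Continuous.add ?_ ?_
      · exact ((continuous_apply _).comp hF).mul ((continuous_apply _).comp continuous_snd)
      · exact ih (fun p u => F p (i :: u))
          (continuous_pi fun u => (continuous_apply (i :: u)).comp hF)
  exact this _ continuous_fst

lemma conv_integral (F : List ℕ+ → ℝ → ℂ) (g : List ℕ+ → ℂ) (s t : ℝ)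
    (hF : ∀ w, IntervalIntegrable (F w) volume s t) (w : List ℕ+) :
    conv (fun u => ∫ x in s..t, F u x) g w = ∫ x in s..t, conv (fun u => F u x) g w := by
  suffices h : IntervalIntegrable (fun x => conv (fun u => F u x) g w) volume s t ∧
      conv (fun u => ∫ x in s..t, F u x) g w = ∫ x in s..t, conv (fun u => F u x) g w from h.2
  induction w generalizing F with
  | nil =>
    refine ⟨(hF []).mul_const _, ?_⟩
    simp only [conv_nil]
    rw [intervalIntegral.integral_mul_const]
  | cons i w ih =>
    obtain ⟨h1, h2⟩ := ih (fun u => F (i :: u)) (fun u => hF _)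
    refine ⟨((hF []).mul_const _).add h1, ?_⟩
    simp only [conv_cons]
    rw [intervalIntegral.integral_add ((hF []).mul_const _) h1,
      intervalIntegral.integral_mul_const, h2]

/-! ### Iterated integrals of products and inverses -/

namespace CoeffSeq

variable {T : ℝ}

lemma iterFrom_mul_right (a b : CoeffSeq T) (w : List ℕ+) (s : ℝ)
    (hs : s ∈ Icc (T / 2) T) :
    iterFrom T (a.mul b).fn w s = iterFrom T a.fn w (2 * s - T) := by
  induction w generalizing s with
  | nil => rfl
  | cons i w ih =>
    have h1 : iterFrom T (a.mul b).fn (i :: w) s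
        = ∫ u in s..T, (2 : ℝ) • (fun y => a.fn i y * iterFrom T a.fn w y) (2 * u - T) := by
      refine intervalIntegral.integral_congr_ae (Eventually.of_forall fun u hu => ?_)
      rw [uIoc_of_le hs.2] at hu
      have hu2 : ¬ u ≤ T / 2 := by linarith [hu.1, hs.1]
      rw [ih u ⟨by linarith [hu.1, hs.1], hu.2⟩]
      simp [mul, hu2, mul_assoc]
    rw [h1, intervalIntegral.integral_smul,
      intervalIntegral.smul_integral_comp_mul_sub
        (fun y => a.fn i y * iterFrom T a.fn w y)]
    simp only [iterFrom]
    congr 1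
    ring

lemma iterFrom_mul_left (hT : 0 < T) (a b : CoeffSeq T) (w : List ℕ+) (s : ℝ)
    (hs : s ∈ Icc 0 (T / 2)) :
    iterFrom T (a.mul b).fn w s
      = conv (fun u => iterFrom T b.fn u (2 * s)) a.iterInt w := by
  induction w generalizing s with
  | nil => simp [iterFrom, conv_nil]
  | cons i w ih =>
    have h0 : iterFrom T (a.mul b).fn (i :: w) s
        = (∫ u in s..(T / 2), (a.mul b).fn i u * iterFrom T (a.mul b).fn w u)
          + iterFrom T (a.mul b).fn (i :: w) (T / 2) :=
      (intervalIntegral.integral_add_adjacent_intervals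
        ((a.mul b).intervalIntegrable_iter i w _ _)
        ((a.mul b).intervalIntegrable_iter i w _ _)).symm
    have h1 : (∫ u in s..(T / 2), (a.mul b).fn i u * iterFrom T (a.mul b).fn w u)
        = ∫ u in s..(T / 2), (2 : ℝ) • (fun y => b.fn i y *
            conv (fun u => iterFrom T b.fn u y) a.iterInt w) (2 * u) := by
      refine intervalIntegral.integral_congr_ae (Eventually.of_forall fun u hu => ?_)
      rw [uIoc_of_le hs.2] at hu
      rw [ih u ⟨by linarith [hu.1, hs.1], hu.2⟩]
      simp [mul, hu.2, mul_assoc]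
    have h2 : (fun y => b.fn i y * conv (fun u => iterFrom T b.fn u y) a.iterInt w)
        = fun y => conv (fun u => b.fn i y * iterFrom T b.fn u y) a.iterInt w := by
      ext y
      rw [conv_smul_left]
    rw [h0, h1, iterFrom_mul_right a b _ _ ⟨le_refl _, by linarith⟩,
      intervalIntegral.integral_smul, intervalIntegral.smul_integral_comp_mul_left
        (fun y => b.fn i y * conv (fun u => iterFrom T b.fn u y) a.iterInt w), h2,
      ← conv_integral _ _ _ _ (fun w => b.intervalIntegrable_iter i w _ _)]
    have e1 : 2 * (T / 2) - T = 0 := by ring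
    have e2 : 2 * (T / 2) = T := by ring
    rw [conv_cons, e1, e2, add_comm]
    simp [iterFrom, iterInt]

/-- Iterated integrals of a product. -/
lemma iterInt_mul (hT : 0 < T) (a b : CoeffSeq T) :
    (a.mul b).iterInt = conv b.iterInt a.iterInt := by
  ext w
  have h := iterFrom_mul_left hT a b w 0 ⟨le_refl _, by linarith⟩
  rw [mul_zero] at h
  exact h

lemma conv_iterFrom_inv (a : CoeffSeq T) (w : List ℕ+) (s : ℝ)
    (hs : s ∈ Icc 0 T) :
    conv (fun u => iterFrom T a.inv.fn u s) a.iterInt w = iterFrom T a.fn w (T - s) := by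
  induction w generalizing s with
  | nil => simp [iterFrom, conv_nil]
  | cons i w ih =>
    have h1 : conv (fun u => iterFrom T a.inv.fn (i :: u) s) a.iterInt w
        = ∫ y in s..T, -(fun x => a.fn i x * iterFrom T a.fn w x) (T - y) := by
      simp only [iterFrom]
      rw [conv_integral _ _ _ _ (fun w => a.inv.intervalIntegrable_iter i w _ _)]
      refine intervalIntegral.integral_congr_ae (Eventually.of_forall fun u hu => ?_)
      rw [uIoc_of_le hs.2] at hu
      rw [conv_smul_left, ih u ⟨by linarith [hu.1, hs.1], hu.2⟩]
      simp [inv]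
    rw [conv_cons, h1, intervalIntegral.integral_neg, intervalIntegral.integral_comp_sub_left
      (fun x => a.fn i x * iterFrom T a.fn w x)]
    have h3 := intervalIntegral.integral_add_adjacent_intervals
        (a.intervalIntegrable_iter i w 0 (T - s)) (a.intervalIntegrable_iter i w (T - s) T)
    simp only [iterInt, iterFrom, one_mul, sub_self]
    rw [← h3]
    ring

lemma conv_inv_left (hT : 0 < T) (a : CoeffSeq T) :
    conv a.inv.iterInt a.iterInt = unitSeries := by
  ext w
  have h := conv_iterFrom_inv a w 0 ⟨le_refl _, hT.le⟩
  refine h.trans ?_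
  cases w with
  | nil => rfl
  | cons i w => simp [iterFrom, unitSeries]

lemma inv_inv (a : CoeffSeq T) : a.inv.inv = a := by
  cases a
  simp [inv]

lemma conv_inv_right (hT : 0 < T) (a : CoeffSeq T) :
    conv a.iterInt a.inv.iterInt = unitSeries := by
  have h := conv_inv_left hT a.inv
  rwa [inv_inv] at h

lemma iterInt_zero : (zero : CoeffSeq T).iterInt = unitSeries := by
  ext w
  cases w with
  | nil => rfl
  | cons i w => simp [iterInt, iterFrom, zero, unitSeries]

/-- The relation `a ∼ b`: all basic iterated integrals (of positive order) vanish at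
`a * b⁻¹`. -/
def Rel (a b : CoeffSeq T) : Prop := ∀ w : List ℕ+, w ≠ [] → (a.mul b.inv).iterInt w = 0

lemma rel_iff (hT : 0 < T) (a b : CoeffSeq T) : Rel a b ↔ a.iterInt = b.iterInt := by
  have h1 : Rel a b ↔ (a.mul b.inv).iterInt = unitSeries := by
    constructor
    · intro h
      ext w
      cases w with
      | nil => rfl
      | cons i w => exact h _ (by simp)
    · intro h w hw
      rw [h]
      cases w with
      | nil => exact absurd rfl hw
      | cons i w => rfl
  rw [h1, iterInt_mul hT]
  constructor
  · intro h
    have h2 := conv_assoc b.iterInt b.inv.iterInt a.iterInt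
    rw [h, conv_unit, conv_inv_right hT, unit_conv] at h2
    exact h2
  · intro h
    rw [h, conv_inv_left hT]

/-- The relation `∼` as an equivalence relation. -/
def setoid (T : ℝ) [hT : Fact (0 < T)] : Setoid (CoeffSeq T) where
  r := Rel
  iseqv :=
    { refl := fun a => (rel_iff hT.out a a).2 rfl
      symm := fun h => (rel_iff hT.out _ _).2 ((rel_iff hT.out _ _).1 h).symm
      trans := fun h h' => (rel_iff hT.out _ _).2
        (((rel_iff hT.out _ _).1 h).trans ((rel_iff hT.out _ _).1 h')) }

end CoeffSeq

/-! ### The group of paths -/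

/-- The group of paths `G(X)`: the set of classes of `∼`. -/
def PathGroup (T : ℝ) [Fact (0 < T)] : Type := Quotient (CoeffSeq.setoid T)

section Paths

variable {T : ℝ} [hT : Fact (0 < T)]

/-- The quotient map `π : X → G(X)`. -/
def toPath (a : CoeffSeq T) : PathGroup T := Quotient.mk (CoeffSeq.setoid T) a

namespace PathGroup

lemma toPath_eq_iff (a b : CoeffSeq T) : toPath a = toPath b ↔ a.iterInt = b.iterInt :=
  Quotient.eq.trans (CoeffSeq.rel_iff hT.out a b)

/-- The basic iterated integrals, as functions on `G(X)`. -/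
def iterInt (g : PathGroup T) : List ℕ+ → ℂ :=
  Quotient.lift (s := CoeffSeq.setoid T) CoeffSeq.iterInt
    (fun a b h => (CoeffSeq.rel_iff hT.out a b).1 h) g

@[simp] lemma iterInt_toPath (a : CoeffSeq T) : iterInt (toPath a) = a.iterInt := rfl

lemma iterInt_injective : Function.Injective (iterInt : PathGroup T → List ℕ+ → ℂ) := by
  intro g h
  induction g using Quotient.inductionOn
  induction h using Quotient.inductionOn
  exact fun e => (toPath_eq_iff _ _).2 e

/-- The product on `G(X)` induced by the product of `X`. -/
instance : Mul (PathGroup T) :=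
  ⟨Quotient.map₂ CoeffSeq.mul fun a a' h b b' h' => by
    refine (CoeffSeq.rel_iff hT.out _ _).2 ?_
    rw [CoeffSeq.iterInt_mul hT.out, CoeffSeq.iterInt_mul hT.out,
      (CoeffSeq.rel_iff hT.out _ _).1 h, (CoeffSeq.rel_iff hT.out _ _).1 h']⟩

instance : One (PathGroup T) := ⟨toPath CoeffSeq.zero⟩

instance : Inv (PathGroup T) :=
  ⟨Quotient.map CoeffSeq.inv fun a b h => by
    refine (CoeffSeq.rel_iff hT.out _ _).2 ?_
    have e := (CoeffSeq.rel_iff hT.out _ _).1 h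
    have h2 := conv_assoc a.inv.iterInt a.iterInt b.inv.iterInt
    rw [CoeffSeq.conv_inv_left hT.out, unit_conv, e, CoeffSeq.conv_inv_right hT.out,
      conv_unit] at h2
    exact h2.symm⟩

@[simp] lemma toPath_mul (a b : CoeffSeq T) : toPath (a.mul b) = toPath a * toPath b := rfl

lemma iterInt_mul (g h : PathGroup T) : (g * h).iterInt = conv h.iterInt g.iterInt := by
  induction g using Quotient.inductionOn
  induction h using Quotient.inductionOn
  exact CoeffSeq.iterInt_mul hT.out _ _

lemma iterInt_one : (1 : PathGroup T).iterInt = unitSeries := CoeffSeq.iterInt_zero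

lemma iterInt_nil (g : PathGroup T) : g.iterInt [] = 1 := by
  induction g using Quotient.inductionOn
  rfl

lemma conv_iterInt_inv (g : PathGroup T) : conv g.iterInt g⁻¹.iterInt = unitSeries := by
  induction g using Quotient.inductionOn
  exact CoeffSeq.conv_inv_right hT.out _

instance : Group (PathGroup T) :=
  Group.ofLeftAxioms
    (fun a b c => iterInt_injective (by simp only [iterInt_mul, conv_assoc]))
    (fun a => iterInt_injective (by rw [iterInt_mul, iterInt_one, conv_unit]))
    (fun a => iterInt_injective (by rw [iterInt_mul, iterInt_one, conv_iterInt_inv]))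

end PathGroup

/-! ### Words of given weight -/

/-- The weight `i₁ + ⋯ + iₖ` of `(i₁, …, iₖ)`. -/
def weight (w : List ℕ+) : ℕ := (w.map (fun i : ℕ+ => (i : ℕ))).sum

lemma weight_nil : weight [] = 0 := rfl

lemma weight_cons (i : ℕ+) (w : List ℕ+) : weight (i :: w) = i + weight w := rfl

lemma finite_weight (n : ℕ) : {w : List ℕ+ | weight w = n}.Finite := by
  induction n using Nat.strong_induction_on with
  | _ n ih =>
    have h : {w : List ℕ+ | weight w = n} ⊆
        {[]} ∪ ⋃ j ∈ Finset.range n, ⋃ i ∈ Finset.Iic n.succPNat,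
          (fun w => i :: w) '' {w : List ℕ+ | weight w = j} := by
      intro w hw
      cases w with
      | nil => exact Or.inl rfl
      | cons i w =>
        right
        have hw' : (i : ℕ) + weight w = n := hw
        have hi := i.pos
        simp only [mem_iUnion]
        refine ⟨weight w, Finset.mem_range.2 (by omega), i, Finset.mem_Iic.2 ?_, w, rfl, rfl⟩
        rw [← PNat.coe_le_coe, Nat.succPNat_coe]
        omega
    refine Finite.subset (Finite.union (finite_singleton _) ?_) h
    refine Finite.biUnion (Finset.finite_toSet _) fun j hj => ?_
    exact Finite.biUnion (Finset.finite_toSet _) fun i _ =>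
      (ih j (Finset.mem_range.1 hj)).image _

/-- The finite set of all `(i₁, …, iₖ)` with `i₁ + ⋯ + iₖ = n`. -/
def words (n : ℕ) : Finset (List ℕ+) := (finite_weight n).toFinset

@[simp] lemma mem_words {n : ℕ} {w : List ℕ+} : w ∈ words n ↔ weight w = n := by
  simp [words]

lemma words_zero : words 0 = {[]} := by
  ext w
  cases w with
  | nil => simp [weight_nil]
  | cons i w => simp [weight_cons]

lemma sum_words_succ {M : Type*} [AddCommMonoid M] (n : ℕ) (F : List ℕ+ → M) :
    ∑ w ∈ words (n + 1), F w
      = ∑ j ∈ Finset.range (n + 1), ∑ w ∈ words (n - j), F (j.succPNat :: w) := by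
  classical
  have h : words (n + 1) = (Finset.range (n + 1)).biUnion
      fun j => (words (n - j)).image (fun w => j.succPNat :: w) := by
    ext w
    simp only [mem_words, Finset.mem_biUnion, Finset.mem_range, Finset.mem_image]
    cases w with
    | nil => simp [weight_nil]
    | cons i w =>
      rw [weight_cons]
      have hi := i.pos
      constructor
      · intro h
        refine ⟨i.natPred, ?_, w, ?_, ?_⟩
        · have := i.natPred_add_one; omega
        · have := i.natPred_add_one; omega
        · rw [PNat.succPNat_natPred]
      · rintro ⟨j, hj, v, hv, e⟩
        obtain ⟨rfl, rfl⟩ := List.cons.inj e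
        rw [Nat.succPNat_coe]
        omega
  rw [h, Finset.sum_biUnion]
  · refine Finset.sum_congr rfl fun j _ => ?_
    rw [Finset.sum_image]
    intro u _ v _ e
    exact (List.cons.inj e).2
  · intro j _ k _ hjk
    rw [Function.onFun, Finset.disjoint_left]
    intro w hw hw'
    obtain ⟨u, _, rfl⟩ := Finset.mem_image.1 hw
    obtain ⟨v, _, e⟩ := Finset.mem_image.1 hw'
    exact hjk (Nat.succPNat_injective (List.cons.inj e).1).symm

lemma card_words_le (n : ℕ) : (words n).card ≤ 2 ^ n := by
  induction n using Nat.strong_induction_on with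
  | _ n ih =>
    cases n with
    | zero => simp [words_zero]
    | succ n =>
      have h := sum_words_succ n (fun _ => 1)
      simp only [Finset.sum_const, smul_eq_mul, mul_one] at h
      rw [h]
      calc ∑ j ∈ Finset.range (n + 1), (words (n - j)).card
          ≤ ∑ j ∈ Finset.range (n + 1), 2 ^ (n - j) :=
            Finset.sum_le_sum fun j _ => ih _ (by omega)
        _ = ∑ j ∈ Finset.range (n + 1), 2 ^ j := by
            rw [← Finset.sum_range_reflect]
            exact Finset.sum_congr rfl fun j hj => by
              have := Finset.mem_range.1 hj
              congr 1
              omega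
        _ ≤ 2 ^ (n + 1) :=
            (Nat.geomSum_lt le_rfl fun k hk => Finset.mem_range.1 hk).le

/-! ### The metric on the group of paths -/

lemma frac_le_one {x : ℝ} (hx : 0 ≤ x) : x / (1 + x) ≤ 1 := by
  rw [div_le_one (by linarith)]
  linarith

lemma frac_mono {x y : ℝ} (hx : 0 ≤ x) (hxy : x ≤ y) : x / (1 + x) ≤ y / (1 + y) := by
  rw [div_le_div_iff₀ (by linarith) (by linarith)]
  nlinarith

lemma frac_add {x y : ℝ} (hx : 0 ≤ x) (hy : 0 ≤ y) :
    (x + y) / (1 + (x + y)) ≤ x / (1 + x) + y / (1 + y) := by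
  rw [add_div]
  gcongr <;> linarith

namespace PathGroup

/-- The `n`-th summand of the distance of `G(X)`. -/
def distTerm (f g : List ℕ+ → ℂ) (n : ℕ) : ℝ :=
  1 / 4 ^ n * ∑ w ∈ words n, ‖f w - g w‖ / (1 + ‖f w - g w‖)

lemma distTerm_nonneg (f g : List ℕ+ → ℂ) (n : ℕ) : 0 ≤ distTerm f g n := by
  unfold distTerm
  positivity

lemma distTerm_le (f g : List ℕ+ → ℂ) (n : ℕ) : distTerm f g n ≤ (1 / 2) ^ n := by
  unfold distTerm
  have h : ∑ w ∈ words n, ‖f w - g w‖ / (1 + ‖f w - g w‖) ≤ 2 ^ n := by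
    calc _ ≤ ∑ w ∈ words n, (1 : ℝ) :=
          Finset.sum_le_sum fun w _ => frac_le_one (norm_nonneg _)
      _ = ((words n).card : ℝ) := by simp
      _ ≤ 2 ^ n := by exact_mod_cast card_words_le n
  calc _ ≤ 1 / 4 ^ n * (2 : ℝ) ^ n := by gcongr
    _ = (1 / 2) ^ n := by
      rw [one_div, one_div, ← inv_pow, ← mul_pow]
      norm_num

lemma summable_bound : Summable fun n : ℕ => ((1 : ℝ) / 2) ^ (n + 1) :=
  (summable_nat_add_iff 1).2 (summable_geometric_of_lt_one (by norm_num) (by norm_num))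

lemma summable_distTerm (f g : List ℕ+ → ℂ) : Summable fun n => distTerm f g (n + 1) :=
  Summable.of_nonneg_of_le (fun _ => distTerm_nonneg f g _) (fun _ => distTerm_le f g _)
    summable_bound

/-- The metric `d` on `G(X)`. -/
instance : MetricSpace (PathGroup T) where
  dist g h := ∑' n : ℕ, distTerm g.iterInt h.iterInt (n + 1)
  dist_self g := by simp [distTerm]
  dist_comm g h := by simp [distTerm, norm_sub_rev]
  dist_triangle f g h := by
    rw [← Summable.tsum_add (summable_distTerm _ _) (summable_distTerm _ _)]
    refine Summable.tsum_le_tsum (fun _ => ?_) (summable_distTerm _ _)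
      ((summable_distTerm _ _).add (summable_distTerm _ _))
    unfold distTerm
    rw [← mul_add, ← Finset.sum_add_distrib]
    gcongr with w _
    refine le_trans (frac_mono (norm_nonneg _) ?_) (frac_add (norm_nonneg _) (norm_nonneg _))
    exact norm_sub_le_norm_sub_add_norm_sub _ _ _
  eq_of_dist_eq_zero := by
    intro g h hgh
    have h0 := (hasSum_zero_iff_of_nonneg (fun n => distTerm_nonneg _ _ _)).1
      (hgh ▸ (summable_distTerm g.iterInt h.iterInt).hasSum)
    refine iterInt_injective ?_
    ext w
    cases w with
    | nil => rw [iterInt_nil, iterInt_nil]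
    | cons i w =>
      obtain ⟨n, hn⟩ : ∃ n, weight (i :: w) = n + 1 :=
        ⟨i.natPred + weight w, by have := i.natPred_add_one; rw [weight_cons]; omega⟩
      have h1 : distTerm g.iterInt h.iterInt (n + 1) = 0 := congrFun h0 n
      unfold distTerm at h1
      rw [mul_eq_zero, or_iff_right (by positivity),
        Finset.sum_eq_zero_iff_of_nonneg (fun w _ => by positivity)] at h1
      have h2 := h1 _ (mem_words.2 hn)
      rw [div_eq_zero_iff, or_iff_left (by positivity), norm_eq_zero] at h2
      exact sub_eq_zero.1 h2

lemma dist_def (g h : PathGroup T) :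
    dist g h = ∑' n : ℕ, distTerm g.iterInt h.iterInt (n + 1) := rfl

lemma uniformContinuous_iterInt :
    UniformContinuous (iterInt : PathGroup T → List ℕ+ → ℂ) := by
  refine uniformContinuous_pi.2 fun w => ?_
  cases w with
  | nil =>
    simp only [iterInt_nil]
    exact uniformContinuous_const
  | cons i w =>
    obtain ⟨n, hn⟩ : ∃ n, weight (i :: w) = n + 1 :=
      ⟨i.natPred + weight w, by have := i.natPred_add_one; rw [weight_cons]; omega⟩
    refine Metric.uniformContinuous_iff.2 fun ε hε => ?_
    refine ⟨1 / 4 ^ (n + 1) * (ε / (1 + ε)), by positivity, fun {g h} hgh => ?_⟩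
    by_contra! hlt
    refine absurd hgh (not_lt.2 ?_)
    rw [dist_eq_norm] at hlt
    have h1 : distTerm g.iterInt h.iterInt (n + 1) ≤ dist g h :=
      (summable_distTerm _ _).le_tsum n (fun m _ => distTerm_nonneg _ _ _)
    refine le_trans ?_ h1
    unfold distTerm
    gcongr
    refine (frac_mono hε.le hlt).trans ?_
    exact Finset.single_le_sum
      (f := fun w => ‖g.iterInt w - h.iterInt w‖ / (1 + ‖g.iterInt w - h.iterInt w‖))
      (fun w _ => by positivity) (mem_words.2 hn)

lemma isUniformInducing_iterInt :
    IsUniformInducing (iterInt : PathGroup T → List ℕ+ → ℂ) := by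
  refine ⟨le_antisymm ?_ (uniformContinuous_iff_le_comap.1 uniformContinuous_iterInt)⟩
  rw [Metric.uniformity_eq_comap_nhds_zero (α := PathGroup T), ← tendsto_iff_comap]
  have h0 : ∀ w : List ℕ+, Tendsto
      (fun p : PathGroup T × PathGroup T => ‖p.1.iterInt w - p.2.iterInt w‖)
      (comap (fun x : PathGroup T × PathGroup T => (x.1.iterInt, x.2.iterInt))
        (uniformity (List ℕ+ → ℂ))) (𝓝 0) := by
    intro w
    have h1 : Tendsto (fun p : (List ℕ+ → ℂ) × (List ℕ+ → ℂ) => (p.1 w, p.2 w))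
        (uniformity (List ℕ+ → ℂ)) (uniformity ℂ) := Pi.uniformContinuous_proj (fun _ => ℂ) w
    rw [Metric.uniformity_eq_comap_nhds_zero] at h1
    have h2 := (tendsto_comap.comp h1).comp
      (tendsto_comap (f := fun x : PathGroup T × PathGroup T => (x.1.iterInt, x.2.iterInt)))
    simpa [Function.comp_def, dist_eq_norm] using h2
  have h1 : Tendsto (fun p : PathGroup T × PathGroup T =>
      ∑' n : ℕ, distTerm p.1.iterInt p.2.iterInt (n + 1))
      (comap (fun x : PathGroup T × PathGroup T => (x.1.iterInt, x.2.iterInt))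
        (uniformity (List ℕ+ → ℂ))) (𝓝 (∑' _ : ℕ, (0 : ℝ))) := by
    refine tendsto_tsum_of_dominated_convergence summable_bound (fun n => ?_)
      (Eventually.of_forall fun p n => ?_)
    · have h2 : Tendsto (fun p : PathGroup T × PathGroup T => 1 / 4 ^ (n + 1) *
          ∑ w ∈ words (n + 1), ‖p.1.iterInt w - p.2.iterInt w‖
            / (1 + ‖p.1.iterInt w - p.2.iterInt w‖))
          (comap (fun x : PathGroup T × PathGroup T => (x.1.iterInt, x.2.iterInt))
            (uniformity (List ℕ+ → ℂ)))
          (𝓝 (1 / 4 ^ (n + 1) * ∑ w ∈ words (n + 1), (0 : ℝ) / (1 + 0))) :=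
        (tendsto_finsetSum _ fun w _ =>
          (h0 w).div ((h0 w).const_add 1) (by norm_num)).const_mul _
      simpa [distTerm] using h2
    · rw [Real.norm_of_nonneg (distTerm_nonneg _ _ _)]
      exact distTerm_le _ _ _
  simpa [dist_def] using h1

end PathGroup

/-! ### The group of formal paths -/

/-- The group of formal paths `G_f(X)`: the completion of `G(X)` with respect to `d`. -/
abbrev FormalPaths (T : ℝ) [Fact (0 < T)] : Type := UniformSpace.Completion (PathGroup T)

/-- Auxiliary recursion for the inverse with respect to `conv`. -/
def convInvAux : ℕ → (List ℕ+ → ℂ) → List ℕ+ → ℂ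
  | 0, _, _ => 1
  | _ + 1, _, [] => 1
  | n + 1, f, i :: w => -conv (fun u => f (i :: u)) (convInvAux n f) w

lemma conv_congr_right (f g g' : List ℕ+ → ℂ) (w : List ℕ+)
    (h : ∀ v : List ℕ+, v.length ≤ w.length → g v = g' v) : conv f g w = conv f g' w := by
  induction w generalizing f with
  | nil => simp [conv_nil, h [] (le_refl _)]
  | cons i w ih =>
    rw [conv_cons, conv_cons, h _ (le_refl _),
      ih _ fun v hv => h v (hv.trans (by simp))]

lemma eq_convInvAux {f g : List ℕ+ → ℂ} (hf : f [] = 1) (h : conv f g = unitSeries) (n : ℕ)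
    (w : List ℕ+) (hw : w.length ≤ n) : g w = convInvAux n f w := by
  have h0 : g [] = 1 := by
    have := congrFun h []
    simpa [conv_nil, hf, unitSeries] using this
  induction n generalizing w with
  | zero =>
    cases w with
    | nil => simpa [convInvAux] using h0
    | cons i w => simp at hw
  | succ n ih =>
    cases w with
    | nil => simpa [convInvAux] using h0
    | cons i w =>
      have h1 := congrFun h (i :: w)
      rw [conv_cons, hf, one_mul] at h1
      have hw' : w.length ≤ n := by simpa using hw
      rw [conv_congr_right _ g (convInvAux n f) w fun v hv => ih v (hv.trans hw')] at h1
      simp only [convInvAux]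
      exact eq_neg_of_add_eq_zero_left h1

lemma continuous_convInvAux (n : ℕ) : Continuous (convInvAux n) := by
  induction n with
  | zero =>
    refine continuous_pi fun w => ?_
    simp only [convInvAux]
    exact continuous_const
  | succ n ih =>
    refine continuous_pi fun w => ?_
    cases w with
    | nil =>
      simp only [convInvAux]
      exact continuous_const
    | cons i w =>
      simp only [convInvAux]
      have h1 : Continuous fun f : List ℕ+ → ℂ => fun u => f (i :: u) :=
        continuous_pi fun u => continuous_apply (i :: u)
      exact ((continuous_apply w).comp (continuous_conv.comp (h1.prodMk ih))).neg

namespace FormalPaths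

open UniformSpace

/-- The inclusion `G(X) ⊂ G_f(X)`. -/
def ofPath (g : PathGroup T) : FormalPaths T := (g : Completion (PathGroup T))

lemma isDenseInducing_ofPath : IsDenseInducing (ofPath : PathGroup T → FormalPaths T) :=
  Completion.isDenseInducing_coe

/-- The basic iterated integrals, extended by continuity from `G(X)` to `G_f(X)`. -/
def iterInt : FormalPaths T → List ℕ+ → ℂ := Completion.extension PathGroup.iterInt

@[simp] lemma iterInt_ofPath (g : PathGroup T) : iterInt (ofPath g) = g.iterInt :=
  Completion.extension_coe PathGroup.uniformContinuous_iterInt g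

lemma continuous_iterInt : Continuous (iterInt : FormalPaths T → List ℕ+ → ℂ) :=
  Completion.continuous_extension

lemma isUniformInducing_iterInt :
    IsUniformInducing (iterInt : FormalPaths T → List ℕ+ → ℂ) :=
  Completion.isUniformInducing_extension PathGroup.isUniformInducing_iterInt

lemma iterInt_injective : Function.Injective (iterInt : FormalPaths T → List ℕ+ → ℂ) :=
  isUniformInducing_iterInt.injective

lemma iterInt_nil (g : FormalPaths T) : iterInt g [] = 1 := by
  induction g using Completion.induction_on with
  | hp => exact isClosed_eq ((continuous_apply []).comp continuous_iterInt) continuous_const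
  | ih g =>
    have h := congrFun (iterInt_ofPath g) []
    rw [PathGroup.iterInt_nil] at h
    exact h

lemma exists_lim {α : Type*} {l : Filter α} [l.NeBot] (u : α → PathGroup T)
    (L : List ℕ+ → ℂ) (h : Tendsto (fun x => (u x).iterInt) l (𝓝 L)) :
    ∃ c : FormalPaths T, iterInt c = L ∧ Tendsto (fun x => ofPath (u x)) l (𝓝 c) := by
  have hc : IsClosed (range (iterInt : FormalPaths T → List ℕ+ → ℂ)) :=
    isUniformInducing_iterInt.isComplete_range.isClosed
  obtain ⟨c, hc⟩ := hc.mem_of_tendsto h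
    (Eventually.of_forall fun x => ⟨ofPath (u x), iterInt_ofPath _⟩)
  refine ⟨c, hc, ?_⟩
  rw [isUniformInducing_iterInt.isInducing.tendsto_nhds_iff, hc]
  simpa [Function.comp_def] using h

lemma tendsto_iterInt_comap (x : FormalPaths T) :
    Tendsto PathGroup.iterInt (comap ofPath (𝓝 x)) (𝓝 (iterInt x)) := by
  have h := (continuous_iterInt.tendsto x).comp (tendsto_comap (f := ofPath))
  simpa [Function.comp_def] using h

/-- The product of `G_f(X)`: the extension by continuity of the product of `G(X)`. -/
instance : Mul (FormalPaths T) :=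
  ⟨fun x y => (isDenseInducing_ofPath.prodMap isDenseInducing_ofPath).extend
    (fun p : PathGroup T × PathGroup T => ofPath (p.1 * p.2)) (x, y)⟩

instance : One (FormalPaths T) := ⟨ofPath 1⟩

/-- The inversion of `G_f(X)`: the extension by continuity of the inversion of `G(X)`. -/
instance : Inv (FormalPaths T) :=
  ⟨isDenseInducing_ofPath.extend (fun g : PathGroup T => ofPath g⁻¹)⟩

lemma tendsto_mul (p : FormalPaths T × FormalPaths T) :
    ∃ c : FormalPaths T, iterInt c = conv (iterInt p.2) (iterInt p.1) ∧
      Tendsto (fun p : PathGroup T × PathGroup T => ofPath (p.1 * p.2))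
        (comap (Prod.map ofPath ofPath) (𝓝 p)) (𝓝 c) := by
  have := ((isDenseInducing_ofPath (T := T)).prodMap (isDenseInducing_ofPath (T := T))).comap_nhds_neBot p
  refine exists_lim _ _ ?_
  simp only [PathGroup.iterInt_mul]
  have h1 : Tendsto (fun q : PathGroup T × PathGroup T => (q.2.iterInt, q.1.iterInt))
      (comap (Prod.map ofPath ofPath) (𝓝 p)) (𝓝 (iterInt p.2, iterInt p.1)) := by
    have h0 := tendsto_comap (f := Prod.map ofPath ofPath) (x := 𝓝 p)
      (α := PathGroup T × PathGroup T)
    refine Tendsto.prodMk_nhds ?_ ?_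
    · exact (tendsto_iterInt_comap p.2).comp
        (tendsto_comap_iff.2 ((continuous_snd.tendsto p).comp h0))
    · exact (tendsto_iterInt_comap p.1).comp
        (tendsto_comap_iff.2 ((continuous_fst.tendsto p).comp h0))
  exact (continuous_conv.tendsto _).comp h1

lemma tendsto_inv (x : FormalPaths T) :
    ∃ c : FormalPaths T, conv (iterInt x) (iterInt c) = unitSeries ∧
      Tendsto (fun g : PathGroup T => ofPath g⁻¹) (comap ofPath (𝓝 x)) (𝓝 c) := by
  have := (isDenseInducing_ofPath (T := T)).comap_nhds_neBot x
  have h : Tendsto (fun g : PathGroup T => g⁻¹.iterInt) (comap ofPath (𝓝 x))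
      (𝓝 (fun w => convInvAux w.length (iterInt x) w)) := by
    refine tendsto_pi_nhds.2 fun w => ?_
    have h1 : (fun g : PathGroup T => g⁻¹.iterInt w)
        = fun g => convInvAux w.length g.iterInt w := by
      ext g
      exact eq_convInvAux g.iterInt_nil g.conv_iterInt_inv _ _ (le_refl _)
    rw [h1]
    exact (((continuous_apply w).comp (continuous_convInvAux w.length)).tendsto _).comp
      (tendsto_iterInt_comap x)
  obtain ⟨c, hc, hl⟩ := exists_lim _ _ h
  refine ⟨c, ?_, hl⟩
  have h2 : Tendsto (fun g : PathGroup T => conv g.iterInt g⁻¹.iterInt) (comap ofPath (𝓝 x))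
      (𝓝 (conv (iterInt x) (iterInt c))) := by
    rw [hc]
    exact (continuous_conv.tendsto (_, _)).comp ((tendsto_iterInt_comap x).prodMk_nhds h)
  simp only [PathGroup.conv_iterInt_inv] at h2
  exact tendsto_nhds_unique h2 tendsto_const_nhds

lemma iterInt_mul (x y : FormalPaths T) :
    iterInt (x * y) = conv (iterInt y) (iterInt x) := by
  obtain ⟨c, hc, hl⟩ := tendsto_mul (x, y)
  have h : x * y = c := IsDenseInducing.extend_eq_of_tendsto _ hl
  rw [h, hc]

lemma iterInt_one : iterInt (1 : FormalPaths T) = unitSeries :=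
  (iterInt_ofPath 1).trans PathGroup.iterInt_one

lemma conv_iterInt_inv (x : FormalPaths T) : conv (iterInt x) (iterInt x⁻¹) = unitSeries := by
  obtain ⟨c, hc, hl⟩ := tendsto_inv x
  have h : x⁻¹ = c := IsDenseInducing.extend_eq_of_tendsto _ hl
  rw [h, hc]

instance : Group (FormalPaths T) :=
  Group.ofLeftAxioms
    (fun a b c => iterInt_injective (by simp only [iterInt_mul, conv_assoc]))
    (fun a => iterInt_injective (by rw [iterInt_mul, iterInt_one, conv_unit]))
    (fun a => iterInt_injective (by rw [iterInt_mul, iterInt_one, conv_iterInt_inv]))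

instance : IsTopologicalGroup (FormalPaths T) where
  continuous_mul := (isDenseInducing_ofPath.prodMap isDenseInducing_ofPath).continuous_extend
    fun p => (tendsto_mul p).imp fun _ h => h.2
  continuous_inv := isDenseInducing_ofPath.continuous_extend
    fun x => (tendsto_inv x).imp fun _ h => h.2

/-- The inclusion `G(X) ⊂ G_f(X)` as a homomorphism of groups. -/
def ofPathHom : PathGroup T →* FormalPaths T where
  toFun := ofPath
  map_one' := rfl
  map_mul' g h := iterInt_injective (by
    rw [iterInt_mul, iterInt_ofPath, iterInt_ofPath, iterInt_ofPath, PathGroup.iterInt_mul])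

end FormalPaths

end Paths

/-! ### Formal power series under composition -/

/-- The set `G[[r]]` of formal power series `r + d₁ r² + d₂ r³ + ⋯`. -/
@[ext]
structure FormalDiffeo where
  series : PowerSeries ℂ
  constantCoeff_series : PowerSeries.constantCoeff series = 0
  coeff_one_series : PowerSeries.coeff 1 series = 1

namespace FormalDiffeo

open PowerSeries

lemma hasSubst (f : FormalDiffeo) : HasSubst f.series :=
  HasSubst.of_constantCoeff_zero' f.constantCoeff_series

lemma eq_X_mul (f : PowerSeries ℂ) (hf : constantCoeff f = 0) : ∃ k, f = X * k :=
  X_dvd_iff.2 hf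

lemma coeff_one_subst (f g : FormalDiffeo) : coeff 1 (f.series.subst g.series) = 1 := by
  obtain ⟨k, hk⟩ := eq_X_mul f.series f.constantCoeff_series
  have h1 : coeff 1 f.series = constantCoeff k := by
    rw [hk]
    simp
  obtain ⟨l, hl⟩ := eq_X_mul g.series g.constantCoeff_series
  have h2 : coeff 1 g.series = constantCoeff l := by
    rw [hl]
    simp
  obtain ⟨k', hk'⟩ := eq_X_mul (k - C (constantCoeff k)) (by simp)
  have h3 : k = C (constantCoeff k) + X * k' := by rw [← hk']; ring
  rw [f.coeff_one_series] at h1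
  rw [g.coeff_one_series] at h2
  rw [← h1, map_one] at h3
  have h4 : f.series.subst g.series = X * (l + X * (l * l * k'.subst g.series)) := by
    rw [hk, h3, subst_mul g.hasSubst, subst_add g.hasSubst, subst_mul g.hasSubst,
      subst_X g.hasSubst]
    have h5 : (1 : PowerSeries ℂ).subst g.series = 1 := by
      rw [← coe_substAlgHom g.hasSubst, map_one]
    rw [h5]
    rw [hl]
    ring
  rw [h4]
  have h6 := coeff_succ_X_mul 0 (l + X * (l * l * k'.subst g.series))
  simp only [zero_add] at h6
  rw [h6]
  simp [← h2]

/-- The product of `G[[r]]` is the composition of series: `(f * g)(r) = f(g(r))`. -/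
instance : Mul FormalDiffeo :=
  ⟨fun f g => ⟨f.series.subst g.series,
    constantCoeff_subst_eq_zero g.constantCoeff_series f.series f.constantCoeff_series, coeff_one_subst f g⟩⟩

instance : One FormalDiffeo := ⟨⟨X, by simp, coeff_one_X⟩⟩

lemma isUnit_coeff (f : FormalDiffeo) : IsUnit (coeff 1 f.series) := by
  rw [f.coeff_one_series]
  exact isUnit_one

instance : Inv FormalDiffeo :=
  ⟨fun f => ⟨f.series.substInvOfIsUnit f.isUnit_coeff,
    by simp, by
      rw [coeff_one_substInvOfIsUnit]
      simp [f.coeff_one_series]⟩⟩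

lemma series_mul (f g : FormalDiffeo) : (f * g).series = f.series.subst g.series := rfl

lemma series_one : (1 : FormalDiffeo).series = X := rfl

lemma series_inv (f : FormalDiffeo) : f⁻¹.series = f.series.substInvOfIsUnit f.isUnit_coeff := rfl

instance : Group FormalDiffeo :=
  Group.ofLeftAxioms
    (fun a b c => FormalDiffeo.ext (by
      simp only [series_mul]
      exact subst_comp_subst_apply b.hasSubst c.hasSubst a.series))
    (fun a => FormalDiffeo.ext (by
      rw [series_mul, series_one]
      exact subst_X a.hasSubst))
    (fun a => FormalDiffeo.ext (by
      rw [series_mul, series_one, series_inv]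
      exact subst_substInvOfIsUnit_left a.series a.constantCoeff_series a.isUnit_coeff))

end FormalDiffeo

/-! ### The first return map -/

/-- The polynomials `p_{i₁, …, iₖ}(t) = (t - i₁ + 1)(t - i₁ - i₂ + 1) ⋯ (t - i₁ - ⋯ - iₖ + 1)`. -/
def returnPoly : List ℕ+ → ℂ → ℂ
  | [], _ => 1
  | i :: w, t => (t - (i : ℂ) + 1) * returnPoly w (t - (i : ℂ))

/-- The series `r + ∑ᵢ (∑_{i₁ + ⋯ + iₖ = i} p_{i₁, …, iₖ}(i) I_{i₁, …, iₖ}) r^{i + 1}`. -/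
def returnSeries (I : List ℕ+ → ℂ) : PowerSeries ℂ :=
  PowerSeries.mk fun
    | 0 => 0
    | 1 => 1
    | i + 2 => ∑ w ∈ words (i + 1), returnPoly w ((i + 1 : ℕ) : ℂ) * I w

section Action

open PowerSeries

/-- The action of functions on words on power series under which the one-letter word `(i)`
corresponds to the vector field `r^{i + 1} d/dr`. -/
def act (f : List ℕ+ → ℂ) (h : PowerSeries ℂ) : PowerSeries ℂ :=
  PowerSeries.mk fun m => ∑ n ∈ Finset.range (m + 1), coeff (m - n) h *
    ∑ w ∈ words n, returnPoly w ((m : ℂ) - 1) * f w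

lemma coeff_act (f : List ℕ+ → ℂ) (h : PowerSeries ℂ) (m : ℕ) :
    coeff m (act f h) = ∑ n ∈ Finset.range (m + 1), coeff (m - n) h *
      ∑ w ∈ words n, returnPoly w ((m : ℂ) - 1) * f w := by
  simp [act]

lemma coeff_act_rec (f : List ℕ+ → ℂ) (h : PowerSeries ℂ) (m : ℕ) :
    coeff m (act f h) = f [] * coeff m h + ∑ j ∈ Finset.range m,
      ((m - 1 - j : ℕ) : ℂ) * coeff (m - 1 - j) (act (fun u => f (j.succPNat :: u)) h) := by
  have hr := Finset.sum_range_diag_flip m (fun j k => ((m - 1 - j : ℕ) : ℂ) *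
    (coeff (m - 1 - j - k) h * ∑ w ∈ words k, returnPoly w (((m - 1 - j : ℕ) : ℂ) - 1) *
      f (j.succPNat :: w)))
  have e1 : ∀ j ∈ Finset.range m,
      ((m - 1 - j : ℕ) : ℂ) * coeff (m - 1 - j) (act (fun u => f (j.succPNat :: u)) h)
      = ∑ k ∈ Finset.range (m - j), ((m - 1 - j : ℕ) : ℂ) *
    (coeff (m - 1 - j - k) h * ∑ w ∈ words k, returnPoly w (((m - 1 - j : ℕ) : ℂ) - 1) *
      f (j.succPNat :: w)) := by
    intro j hj
    have hj := Finset.mem_range.1 hj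
    have e : m - j = m - 1 - j + 1 := by omega
    rw [coeff_act, Finset.mul_sum, e]
  rw [Finset.sum_congr rfl e1, ← hr, coeff_act, Finset.sum_range_succ', add_comm]
  congr 1
  · simp [words_zero, returnPoly, mul_comm]
  · refine Finset.sum_congr rfl fun n hn => ?_
    have hn := Finset.mem_range.1 hn
    rw [sum_words_succ, Finset.mul_sum]
    refine Finset.sum_congr rfl fun j hj => ?_
    replace hj := Finset.mem_range.1 hj
    have e2 : m - 1 - j - (n - j) = m - (n + 1) := by omega
    have e3 : ((m - 1 - j : ℕ) : ℂ) = (m : ℂ) - 1 - j := by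
      rw [Nat.cast_sub (by omega), Nat.cast_sub (by omega), Nat.cast_one]
    rw [e2, Finset.mul_sum, Finset.mul_sum, Finset.mul_sum]
    refine Finset.sum_congr rfl fun w _ => ?_
    simp only [returnPoly, Nat.succPNat_coe, Nat.cast_succ]
    rw [e3]
    have e4 : (m : ℂ) - 1 - (j + 1) = m - 1 - j - 1 := by ring
    rw [e4]
    ring

lemma act_zero_left (h : PowerSeries ℂ) : act (fun _ => 0) h = 0 := by
  ext m
  simp [coeff_act]

lemma act_add_left (f g : List ℕ+ → ℂ) (h : PowerSeries ℂ) :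
    act (fun w => f w + g w) h = act f h + act g h := by
  ext m
  simp only [map_add, coeff_act, mul_add, Finset.sum_add_distrib]

lemma act_smul_left (c : ℂ) (f : List ℕ+ → ℂ) (h : PowerSeries ℂ) :
    act (fun w => c * f w) h = C c * act f h := by
  ext m
  simp only [coeff_C_mul, coeff_act, Finset.mul_sum]
  refine Finset.sum_congr rfl fun n _ => Finset.sum_congr rfl fun w _ => ?_
  ring

lemma act_add_right (f : List ℕ+ → ℂ) (h k : PowerSeries ℂ) :
    act f (h + k) = act f h + act f k := by
  ext m
  simp only [map_add, coeff_act, add_mul, Finset.sum_add_distrib]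

lemma act_unit (h : PowerSeries ℂ) : act unitSeries h = h := by
  ext m
  rw [coeff_act_rec]
  simp [act_zero_left, unitSeries]

lemma act_conv (f g : List ℕ+ → ℂ) (h : PowerSeries ℂ) :
    act (conv f g) h = act f (act g h) := by
  ext m
  induction m using Nat.strong_induction_on generalizing f with
  | _ m ih =>
    have e : ∀ j : ℕ, (fun u => conv f g (j.succPNat :: u)) = fun u =>
        f [] * g (j.succPNat :: u) + conv (fun u => f (j.succPNat :: u)) g u := fun _ => rfl
    rw [coeff_act_rec, coeff_act_rec f, coeff_act_rec g, conv_nil, mul_add, ← mul_assoc,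
      add_assoc, Finset.mul_sum, ← Finset.sum_add_distrib]
    congr 1
    refine Finset.sum_congr rfl fun j hj => ?_
    have hj := Finset.mem_range.1 hj
    rw [e, act_add_left (fun u => f [] * g (j.succPNat :: u)), map_add, act_smul_left,
      coeff_C_mul, ih _ (by omega)]
    ring

lemma act_one {f : List ℕ+ → ℂ} (hf : f [] = 1) : act f 1 = 1 := by
  have : ∀ (m : ℕ) (f : List ℕ+ → ℂ), coeff m (act f 1) = f [] * coeff m 1 := by
    intro m
    induction m using Nat.strong_induction_on with
    | _ m ih =>
      intro f
      rw [coeff_act_rec, Finset.sum_eq_zero, add_zero]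
      intro j hj
      have hj := Finset.mem_range.1 hj
      rw [ih _ (by omega), coeff_one]
      split_ifs with h
      · simp [h]
      · simp
  ext m
  rw [this, hf, one_mul]

lemma act_X {f : List ℕ+ → ℂ} (hf : f [] = 1) : act f X = returnSeries f := by
  ext m
  rw [coeff_act]
  cases m with
  | zero => simp [returnSeries]
  | succ m =>
    rw [Finset.sum_eq_single m]
    · have e : m + 1 - m = 1 := by omega
      rw [e, coeff_one_X, one_mul]
      cases m with
      | zero => simp [returnSeries, words_zero, returnPoly, hf]
      | succ m => simp [returnSeries]
    · intro n hn hnm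
      have hn := Finset.mem_range.1 hn
      rw [coeff_X, if_neg (by omega), zero_mul]
    · intro h
      exact absurd (Finset.mem_range.2 (by omega)) h

lemma coeff_act_congr (f : List ℕ+ → ℂ) (h k : PowerSeries ℂ) (m : ℕ)
    (hk : ∀ n ≤ m, coeff n h = coeff n k) : coeff m (act f h) = coeff m (act f k) := by
  rw [coeff_act, coeff_act]
  refine Finset.sum_congr rfl fun n _ => ?_
  rw [hk _ (Nat.sub_le _ _)]

/-- The action of `f` is multiplicative. -/
def IsMult (f : List ℕ+ → ℂ) : Prop := ∀ h k : PowerSeries ℂ, act f (h * k) = act f h * act f k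

lemma returnSeries_mem (f : List ℕ+ → ℂ) :
    constantCoeff (returnSeries f) = 0 ∧ coeff 1 (returnSeries f) = 1 := by
  constructor
  · rw [← coeff_zero_eq_constantCoeff_apply]
    simp [returnSeries]
  · simp [returnSeries]

lemma act_eq_subst {f : List ℕ+ → ℂ} (hf : f [] = 1) (hm : IsMult f) (h : PowerSeries ℂ) :
    act f h = h.subst (returnSeries f) := by
  have hs : HasSubst (returnSeries f) := HasSubst.of_constantCoeff_zero' (returnSeries_mem f).1
  have hC : ∀ c : ℂ, act f (C c) = C c := by
    intro c
    have : act f (C c) = C c * act f 1 := by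
      ext m
      rw [coeff_C_mul]
      simp only [coeff_act, Finset.mul_sum, ← mul_assoc]
      refine Finset.sum_congr rfl fun n _ => Finset.sum_congr rfl fun w _ => ?_
      congr 2
      rw [coeff_C, coeff_one]
      split_ifs <;> simp
    rw [this, act_one hf, mul_one]
  have hmul : ∀ h k : PowerSeries ℂ, (h * k).subst (returnSeries f)
      = h.subst (returnSeries f) * k.subst (returnSeries f) := subst_mul hs
  -- the difference is divisible by every power of the variable
  have key : ∀ (n : ℕ) (h : PowerSeries ℂ),
      X ^ n ∣ act f h - h.subst (returnSeries f) := by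
    intro n
    induction n with
    | zero => intro h; simp
    | succ n ih =>
      intro h
      obtain ⟨k, hk⟩ := FormalDiffeo.eq_X_mul (h - C (constantCoeff h)) (by simp)
      have h3 : h = C (constantCoeff h) + X * k := by rw [← hk]; ring
      have hCs : (C (constantCoeff h)).subst (returnSeries f) = C (constantCoeff h) := by
        exact subst_C _
      have h4 : act f h - h.subst (returnSeries f)
          = returnSeries f * (act f k - k.subst (returnSeries f)) := by
        conv_lhs => rw [h3]
        rw [act_add_right, hC, hm, act_X hf, subst_add hs, hmul, subst_X hs, hCs]
        ring
      rw [h4, pow_succ']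
      exact mul_dvd_mul (X_dvd_iff.2 (returnSeries_mem f).1) (ih k)
  ext m
  have h1 := X_pow_dvd_iff.1 (key (m + 1) h) m (by omega)
  rw [map_sub] at h1
  exact sub_eq_zero.1 h1

end Action

/-! ### Multiplicativity for iterated integrals -/

namespace CoeffSeq

open PowerSeries

variable {T : ℝ}

lemma ac_sum {ι : Type*} (s : Finset ι) (F : ι → ℝ → ℂ) (a b : ℝ)
    (h : ∀ i ∈ s, AbsolutelyContinuousOnInterval (F i) a b) :
    AbsolutelyContinuousOnInterval (fun x => ∑ i ∈ s, F i x) a b := by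
  classical
  induction s using Finset.induction_on with
  | empty =>
    simp only [Finset.sum_empty]
    exact (LipschitzWith.const (0 : ℂ)).lipschitzOnWith |>.absolutelyContinuousOnInterval
  | insert i s hi ih =>
    simp only [Finset.sum_insert hi]
    exact (h i (Finset.mem_insert_self _ _)).fun_add
      (ih fun j hj => h j (Finset.mem_insert_of_mem hj))

lemma ac_iterFrom (a : CoeffSeq T) (w : List ℕ+) :
    AbsolutelyContinuousOnInterval (iterFrom T a.fn w) 0 T := by
  cases w with
  | nil =>
    exact (LipschitzWith.const (1 : ℂ)).lipschitzOnWith |>.absolutelyContinuousOnInterval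
  | cons i w =>
    obtain ⟨C, hC⟩ := a.exists_norm_le i
    obtain ⟨D, hD⟩ := (isCompact_uIcc (a := (0 : ℝ)) (b := T)).exists_bound_of_continuousOn
      (a.continuous_iterFrom w).continuousOn
    have hC0 : 0 ≤ C := (norm_nonneg _).trans (hC 0)
    have hD0 : 0 ≤ D := (norm_nonneg _).trans (hD 0 left_mem_uIcc)
    have hl : LipschitzOnWith (C * D).toNNReal (iterFrom T a.fn (i :: w)) (uIcc 0 T) := by
      refine LipschitzOnWith.of_dist_le_mul fun x hx y hy => ?_
      rw [Real.coe_toNNReal _ (by positivity), dist_eq_norm, dist_comm, Real.dist_eq]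
      have e : iterFrom T a.fn (i :: w) x - iterFrom T a.fn (i :: w) y
          = ∫ u in x..y, a.fn i u * iterFrom T a.fn w u := by
        have := intervalIntegral.integral_add_adjacent_intervals
          (a.intervalIntegrable_iter i w x y) (a.intervalIntegrable_iter i w y T)
        simp only [iterFrom]
        rw [← this]
        ring
      rw [e]
      refine intervalIntegral.norm_integral_le_of_norm_le_const fun u hu => ?_
      rw [norm_mul]
      exact mul_le_mul (hC u) (hD u (uIcc_subset_uIcc hx hy (uIoc_subset_uIcc hu)))
        (norm_nonneg _) hC0
    exact hl.absolutelyContinuousOnInterval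

/-- The derivative of `iterFrom`. -/
def iterDeriv (a : CoeffSeq T) (s : ℝ) : List ℕ+ → ℂ
  | [] => 0
  | i :: w => -(a.fn i s) * iterFrom T a.fn w s

lemma ae_hasDerivAt_iterFrom (a : CoeffSeq T) :
    ∀ᵐ s : ℝ, s ∈ uIcc 0 T → ∀ w, HasDerivAt (iterFrom T a.fn w) (a.iterDeriv s w) s := by
  have h : ∀ w : List ℕ+, ∀ᵐ s : ℝ, s ∈ uIcc 0 T →
      HasDerivAt (iterFrom T a.fn w) (a.iterDeriv s w) s := by
    intro w
    cases w with
    | nil => exact Eventually.of_forall fun s _ => hasDerivAt_const s 1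
    | cons i w =>
      filter_upwards [(a.intervalIntegrable_iter i w 0 T).ae_hasDerivAt_integral] with s hs hs'
      have h1 := (hs hs' T right_mem_uIcc).neg
      have e : iterFrom T a.fn (i :: w)
          = -fun x => ∫ u in T..x, a.fn i u * iterFrom T a.fn w u := by
        ext x
        exact intervalIntegral.integral_symm _ _
      have e2 : a.iterDeriv s (i :: w) = -(a.fn i s * iterFrom T a.fn w s) := neg_mul _ _
      rw [e, e2]
      exact h1
  filter_upwards [ae_all_iff.2 h] with s hs hs' w using hs w hs'

/-- The series `a₁(s) r + a₂(s) r² + ⋯`. -/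
def vec (a : CoeffSeq T) (s : ℝ) : PowerSeries ℂ :=
  PowerSeries.mk fun
    | 0 => 0
    | n + 1 => a.fn n.succPNat s

lemma coeff_vec_mul (a : CoeffSeq T) (s : ℝ) (g : PowerSeries ℂ) (m : ℕ) :
    coeff m (a.vec s * (X * derivative ℂ g)) = ∑ j ∈ Finset.range m,
      a.fn j.succPNat s * (((m - 1 - j : ℕ) : ℂ) * coeff (m - 1 - j) g) := by
  have h : ∀ k, coeff k (X * derivative ℂ g) = (k : ℂ) * coeff k g := by
    intro k
    cases k with
    | zero => simp
    | succ k =>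
      rw [coeff_succ_X_mul, coeff_derivative]
      push_cast
      ring
  rw [coeff_mul, Finset.Nat.sum_antidiagonal_eq_sum_range_succ
    (fun i k => coeff i (a.vec s) * coeff k (X * derivative ℂ g)), Finset.sum_range_succ']
  simp only [h]
  have h0 : coeff 0 (a.vec s) = 0 := by simp [vec]
  rw [h0, zero_mul, add_zero]
  refine Finset.sum_congr rfl fun j _ => ?_
  have e : m - (j + 1) = m - 1 - j := by omega
  rw [e]
  simp [vec]

lemma ac_coeff_act (a : CoeffSeq T) (h : PowerSeries ℂ) (m : ℕ) :
    AbsolutelyContinuousOnInterval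
      (fun s => coeff m (act (fun w => iterFrom T a.fn w s) h)) 0 T := by
  simp only [coeff_act]
  refine ac_sum _ _ _ _ fun n _ => AbsolutelyContinuousOnInterval.const_smul (M := ℂ) _ ?_
  exact ac_sum _ _ _ _ fun w _ => (a.ac_iterFrom w).const_smul (M := ℂ) _

lemma hasDerivAt_coeff_act (a : CoeffSeq T) (s : ℝ)
    (hs : ∀ w, HasDerivAt (iterFrom T a.fn w) (a.iterDeriv s w) s)
    (h : PowerSeries ℂ) (m : ℕ) :
    HasDerivAt (fun s => coeff m (act (fun w => iterFrom T a.fn w s) h))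
      (-coeff m (a.vec s * (X * derivative ℂ (act (fun w => iterFrom T a.fn w s) h)))) s := by
  have h1 : HasDerivAt (fun s => coeff m (act (fun w => iterFrom T a.fn w s) h))
      (coeff m (act (a.iterDeriv s) h)) s := by
    simp only [coeff_act]
    exact HasDerivAt.fun_sum fun n _ => (HasDerivAt.fun_sum fun w _ =>
      (hs w).const_mul _).const_mul _
  convert h1 using 1
  rw [coeff_vec_mul, coeff_act_rec, ← Finset.sum_neg_distrib]
  have e : ∀ j : ℕ, (fun u => a.iterDeriv s (j.succPNat :: u))
      = fun u => -(a.fn j.succPNat s) * iterFrom T a.fn u s := fun _ => rfl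
  simp only [e, act_smul_left, coeff_C_mul]
  simp only [iterDeriv, zero_mul, zero_add]
  refine Finset.sum_congr rfl fun j _ => ?_
  ring

lemma isMult_iterInt (a : CoeffSeq T) : IsMult a.iterInt := by
  intro h k
  set F : ℝ → List ℕ+ → ℂ := fun s w => iterFrom T a.fn w s with hF
  let G : ℝ → PowerSeries ℂ := fun s => act (F s) h * act (F s) k - act (F s) (h * k)
  have hG : ∀ s m, coeff m (G s) = (∑ p ∈ Finset.HasAntidiagonal.antidiagonal m,
      coeff p.1 (act (F s) h) * coeff p.2 (act (F s) k)) - coeff m (act (F s) (h * k)) := by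
    intro s m
    simp only [G, map_sub, coeff_mul]
  have hac : ∀ m, AbsolutelyContinuousOnInterval (fun s => coeff m (G s)) 0 T := by
    intro m
    simp only [hG]
    refine AbsolutelyContinuousOnInterval.fun_sub ?_ (a.ac_coeff_act _ _)
    exact ac_sum _ _ _ _ fun p _ =>
      (a.ac_coeff_act h p.1).fun_smul (M := ℂ) (a.ac_coeff_act k p.2)
  have hder : ∀ m, ∀ᵐ s : ℝ, s ∈ uIcc 0 T → HasDerivAt (fun s => coeff m (G s))
      (-coeff m (a.vec s * (X * derivative ℂ (G s)))) s := by
    intro m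
    filter_upwards [a.ae_hasDerivAt_iterFrom] with s hs hs'
    have hs := hs hs'
    have h1 : HasDerivAt (fun s => coeff m (G s))
        ((∑ p ∈ Finset.HasAntidiagonal.antidiagonal m,
          (-coeff p.1 (a.vec s * (X * derivative ℂ (act (F s) h))) * coeff p.2 (act (F s) k)
            + coeff p.1 (act (F s) h) *
              -coeff p.2 (a.vec s * (X * derivative ℂ (act (F s) k)))))
          - -coeff m (a.vec s * (X * derivative ℂ (act (F s) (h * k))))) s := by
      simp only [hG]
      refine HasDerivAt.fun_sub (HasDerivAt.fun_sum fun p _ => ?_)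
        (a.hasDerivAt_coeff_act s hs _ m)
      exact (a.hasDerivAt_coeff_act s hs h p.1).fun_mul (a.hasDerivAt_coeff_act s hs k p.2)
    convert h1 using 1
    have e : a.vec s * (X * derivative ℂ (G s))
        = (a.vec s * (X * derivative ℂ (act (F s) h))) * act (F s) k
          + act (F s) h * (a.vec s * (X * derivative ℂ (act (F s) k)))
          - a.vec s * (X * derivative ℂ (act (F s) (h * k))) := by
      simp only [G, map_sub, Derivation.leibniz, smul_eq_mul]
      ring
    rw [e, map_sub, map_add, coeff_mul, coeff_mul, ← Finset.sum_add_distrib]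
    simp only [neg_mul, mul_neg, ← neg_add, Finset.sum_neg_distrib]
    ring
  have hT' : G T = 0 := by
    have e : F T = unitSeries := by
      ext w
      cases w with
      | nil => rfl
      | cons i w => simp [hF, iterFrom, unitSeries]
    simp only [G, e, act_unit, sub_self]
  have hzero : ∀ m, ∀ s ∈ uIcc 0 T, coeff m (G s) = 0 := by
    intro m
    induction m using Nat.strong_induction_on with
    | _ m ih =>
      have h0 : ∀ᵐ s : ℝ, s ∈ uIcc 0 T → HasDerivAt (fun s => coeff m (G s)) 0 s := by
        filter_upwards [hder m] with s hs hs'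
        convert hs hs' using 1
        rw [coeff_vec_mul, Finset.sum_eq_zero, neg_zero]
        intro j hj
        have hj := Finset.mem_range.1 hj
        rw [ih _ (by omega) s hs']
        ring
      obtain ⟨C, hC⟩ := (hac m).const_of_ae_hasDerivAt_zero h0
      intro s hs
      rw [hC s hs, ← hC T right_mem_uIcc, hT']
      simp
  have h3 : G 0 = 0 := by
    ext m
    rw [hzero m 0 left_mem_uIcc]
    simp
  exact (sub_eq_zero.1 h3).symm

end CoeffSeq

/-! ### Formal centers and centers -/

namespace FormalPaths

open UniformSpace PowerSeries

variable {T : ℝ} [Fact (0 < T)]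

lemma isMult_iterInt (g : FormalPaths T) : IsMult (iterInt g) := by
  have hc : ∀ (h : PowerSeries ℂ) (m : ℕ),
      Continuous fun g : FormalPaths T => coeff m (act (iterInt g) h) := by
    intro h m
    simp only [coeff_act]
    exact continuous_finsetSum _ fun n _ => continuous_const.mul
      (continuous_finsetSum _ fun w _ => continuous_const.mul
        ((continuous_apply w).comp continuous_iterInt))
  intro h k
  ext m
  induction g using Completion.induction_on with
  | hp =>
    simp only [coeff_mul]
    exact isClosed_eq (hc _ _) (continuous_finsetSum _ fun p _ => (hc _ _).mul (hc _ _))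
  | ih g =>
    induction g using Quotient.inductionOn with
    | _ a =>
      have e : iterInt (Completion.coe' (toPath a)) = a.iterInt := iterInt_ofPath (toPath a)
      exact congrArg (coeff m) (by
        simp only [toPath] at e
        rw [e]
        exact a.isMult_iterInt h k)

/-- The homomorphism `P̂ : G_f(X) → G[[r]]`. -/
def returnMap : FormalPaths T →* FormalDiffeo where
  toFun g := ⟨returnSeries (iterInt g), (returnSeries_mem _).1, (returnSeries_mem _).2⟩
  map_one' := FormalDiffeo.ext (by
    simp only [iterInt_one]
    rw [← act_X (f := unitSeries) rfl, act_unit]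
    rfl)
  map_mul' g h := FormalDiffeo.ext (by
    change returnSeries (iterInt (g * h))
      = (returnSeries (iterInt g)).subst (returnSeries (iterInt h))
    rw [← act_eq_subst (iterInt_nil h) (isMult_iterInt h), ← act_X (iterInt_nil g), ← act_conv,
      ← iterInt_mul, act_X (iterInt_nil _)])

end FormalPaths

/-- The group of formal centers `Ĉ_f = Ker P̂`. -/
def formalCenters (T : ℝ) [Fact (0 < T)] : Subgroup (FormalPaths T) :=
  FormalPaths.returnMap.ker

/-- `v` is a Lipschitz solution on `[0, T]` of `dv/dx = ∑_{i ≥ 1} aᵢ(x) v^{i + 1}`. -/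
def IsSolution {T : ℝ} (a : CoeffSeq T) (v : ℝ → ℂ) : Prop :=
  (∃ K, LipschitzOnWith K v (Icc 0 T)) ∧
    ∀ᵐ x ∂(volume.restrict (Icc 0 T)), ∃ s : ℂ,
      HasSum (fun i : ℕ+ => a.fn i x * v x ^ ((i : ℕ) + 1)) s ∧ HasDerivAt v s x

/-- The set `C ⊆ X` of centers: every solution with a sufficiently small initial value satisfies
`v(T) = v(0)`. -/
def centers (T : ℝ) : Set (CoeffSeq T) :=
  {a | ∃ ε > 0, ∀ v : ℝ → ℂ, IsSolution a v → ‖v 0‖ < ε → v T = v 0}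

end CenterProblem

end

noncomputable section

namespace CenterProblem

open MeasureTheory Set Filter Topology
open scoped Interval

/-! ### A mean value inequality -/

/-! Write `F(s, r) = ∑ aᵢ(s) r^{i+1}`, and let `h(s, r)` be the return series formed with iterated
integrals over `[s, T]`; its coefficients are `flowCoeff a m s`. It solves the transport equation
`∂ₛh + F ∂ᵣh = 0` coefficientwise, with `h(T, r) = r`. Its coefficients grow at most geometrically
(`exists_flowCoeff_le`), so it converges for small `r` and is constant along small solutions: `v(T)
= h(0, v(0))` (`IsSolution.tendsto_sum`). Solutions exist for all small initial values
(`exists_isSolution`), so the identity theorem shows that `a` is a center exactly when `h(0, r) =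
r`, that is, when `P̂` is trivial at its class (`mem_centers_iff`). The centers thus form the trace
of `Ker P̂` on `G(X)`, which gives the subgroup and the inclusion.

Density needs more, since a dense subgroup may meet a closed subgroup in a set that is not dense
there. The point is that elements of `G[[r]]` close to the identity, with geometrically bounded
coefficients, lift to elements of `G(X)` close to the identity. Given `r + γ`, join it to `r` by the
line `r + λ(s) γ` with `λ(s) = (T - s)/T`. The transport equation along this line can be solved for
the field: `F = T⁻¹ γ / (1 + λ γ')`. Its coefficients are again geometrically bounded, so they
define an element of `X` with return series `r + γ` (`returnSeries_ofGenerator`), and the `i`-th one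
is small when the coefficients of `γ` up to index `i + 1` are (`norm_ofGenerator_le`).

Now let `g ∈ Ker P̂` and let classes of `a ∈ X` tend to `g`. Then `P̂(a⁻¹)` tends to `r`
coefficientwise. Lifting `P̂(a⁻¹)` as above gives `c` with class tending to the identity
(`tendsto_iterInt_correction`). The product `a * c` is a center (`mul_correction_mem`), and its
class tends to `g`. -/

lemma norm_sub_le_of_ae_hasDerivAt {F F' : ℝ → ℂ} {a b M : ℝ} (hab : a ≤ b) (hM : 0 ≤ M)
    (hF : AbsolutelyContinuousOnInterval F a b)
    (hd : ∀ᵐ x : ℝ, x ∈ Icc a b → HasDerivAt F (F' x) x ∧ ‖F' x‖ ≤ M) :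
    ‖F b - F a‖ ≤ M * (b - a) := by
  -- The derivative is cut off where its norm exceeds `M`, so that it becomes bounded everywhere.
  -- The primitive of the cut-off is Lipschitz, and `F` minus this primitive is absolutely
  -- continuous with derivative zero almost everywhere, hence constant.
  set S : Set ℝ := {x | ‖deriv F x‖ ≤ M}
  have hS : MeasurableSet S := (measurable_deriv F).norm measurableSet_Iic
  set g : ℝ → ℂ := S.indicator (deriv F)
  have hg : Measurable g := (measurable_deriv F).indicator hS
  have hgM : ∀ x, ‖g x‖ ≤ M := by
    intro x
    by_cases hx : x ∈ S
    · have h : ‖deriv F x‖ ≤ M := hx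
      simpa only [g, indicator_of_mem hx] using h
    · simpa [g, hx] using hM
  have hint : ∀ s t, IntervalIntegrable g volume s t := fun s t =>
    (intervalIntegrable_const (c := M)).mono_fun' hg.aestronglyMeasurable
      (Eventually.of_forall hgM)
  have hlip : LipschitzWith M.toNNReal fun x => ∫ u in a..x, g u := by
    refine LipschitzWith.of_dist_le_mul fun x y => ?_
    rw [Real.coe_toNNReal _ hM, dist_eq_norm, dist_comm, Real.dist_eq,
      ← norm_neg, neg_sub, intervalIntegral.integral_interval_sub_left (hint _ _) (hint _ _)]
    exact intervalIntegral.norm_integral_le_of_norm_le_const fun u _ => hgM u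
  have hac : AbsolutelyContinuousOnInterval (fun x => F x - ∫ u in a..x, g u) a b :=
    hF.fun_sub (hlip.lipschitzOnWith).absolutelyContinuousOnInterval
  obtain ⟨c, hc⟩ := hac.const_of_ae_hasDerivAt_zero (by
    filter_upwards [hd, (hint a b).ae_hasDerivAt_integral] with x hx hx' hxm
    obtain ⟨h1, h2⟩ := hx (by rwa [uIcc_of_le hab] at hxm)
    have h3 : g x = F' x := by
      have : x ∈ S := by simpa [S, h1.deriv] using h2
      simp [g, this, h1.deriv]
    have := h1.sub (hx' hxm a left_mem_uIcc)
    rwa [h3, sub_self] at this)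
  have h1 := hc a left_mem_uIcc
  have h2 := hc b right_mem_uIcc
  simp only [intervalIntegral.integral_same, sub_zero] at h1
  have h3 : F b - F a = ∫ u in a..b, g u := by
    rw [h1, ← h2]; ring
  rw [h3, ← abs_of_nonneg (sub_nonneg.2 hab)]
  exact intervalIntegral.norm_integral_le_of_norm_le_const fun u _ => hgM u

/-! ### Bounds for iterated integrals and for the flow -/

namespace CoeffSeq

open PowerSeries

variable {T : ℝ}

lemma exists_norm_le_pow (a : CoeffSeq T) :
    ∃ C : ℝ, 1 ≤ C ∧ ∀ i x, ‖a.fn i x‖ ≤ C ^ (i : ℕ) := by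
  obtain ⟨C, hC⟩ := a.bound_coeff
  refine ⟨max 1 C, le_max_left _ _, fun i x => ?_⟩
  have h := pow_le_pow_left₀ (by positivity) ((hC i x).trans (le_max_right 1 C)) (i : ℕ)
  rwa [Real.rpow_inv_natCast_pow (norm_nonneg _) i.ne_zero] at h

/-- The last factor is the volume of the simplex `s ≤ s₁ ≤ ⋯ ≤ sₖ ≤ T`. Bounds are asked only for
the letters of `w`, because the density argument controls finitely many coefficients at a time. -/
lemma norm_iterFrom_le (a : CoeffSeq T) (c : ℕ+ → ℝ) (w : List ℕ+)
    (hc : ∀ i ∈ w, ∀ x, ‖a.fn i x‖ ≤ c i) (s : ℝ) (hs : s ≤ T) :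
    ‖iterFrom T a.fn w s‖ ≤ (w.map c).prod * ((T - s) ^ w.length / w.length.factorial) := by
  induction w generalizing s with
  | nil => simp [iterFrom]
  | cons i w ih =>
    have hc0 : 0 ≤ c i := (norm_nonneg _).trans (hc i (by simp) 0)
    have h1 : ‖iterFrom T a.fn (i :: w) s‖ ≤
        ∫ u in s..T, c i * ((w.map c).prod * ((T - u) ^ w.length / w.length.factorial)) := by
      refine intervalIntegral.norm_integral_le_of_norm_le hs
        (Eventually.of_forall fun u hu => ?_)
        (Continuous.intervalIntegrable (by fun_prop) _ _)
      rw [norm_mul]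
      exact mul_le_mul (hc i (by simp) u)
        (ih (fun j hj => hc j (List.mem_cons_of_mem _ hj)) u hu.2) (norm_nonneg _) hc0
    refine h1.trans (le_of_eq ?_)
    have h2 : ∫ u in s..T, (T - u) ^ w.length = (T - s) ^ (w.length + 1) / (w.length + 1) := by
      rw [intervalIntegral.integral_comp_sub_left (fun x => x ^ w.length)]
      simp
    simp only [intervalIntegral.integral_const_mul, intervalIntegral.integral_div, h2,
      List.map_cons, List.prod_cons, List.length_cons, Nat.factorial_succ]
    push_cast
    field_simp

end CoeffSeq

/-- At `t = m - 1`, the value that enters the coefficient of `r^m`, the factors are the integers `m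
- i₁`, `m - i₁ - i₂`, and so on. They lie between `0` and `m` because the weight is at most `m`. -/
lemma norm_returnPoly_le (w : List ℕ+) (m : ℕ) (hw : weight w ≤ m) :
    ‖returnPoly w ((m : ℂ) - 1)‖ ≤ (m : ℝ) ^ w.length := by
  induction w generalizing m with
  | nil => simp [returnPoly]
  | cons i w ih =>
    rw [weight_cons] at hw
    have e : (m : ℂ) - i = ((m - i : ℕ) : ℂ) := by
      rw [Nat.cast_sub (by omega)]
    have e1 : (m : ℂ) - 1 - i + 1 = ((m - i : ℕ) : ℂ) := by rw [← e]; ring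
    have e2 : (m : ℂ) - 1 - i = ((m - i : ℕ) : ℂ) - 1 := by rw [← e]; ring
    have h1 : ((m - i : ℕ) : ℝ) ≤ m := by exact_mod_cast Nat.sub_le _ _
    rw [returnPoly, e1, e2, norm_mul, List.length_cons, pow_succ', Complex.norm_natCast]
    exact mul_le_mul h1 ((ih _ (by omega)).trans (pow_le_pow_left₀ (by positivity) h1 _))
      (norm_nonneg _) (by positivity)

namespace CoeffSeq

open PowerSeries

variable {T : ℝ}

/-- The coefficients of the flow of the equation from time `s` to time `T`, as a function of the
initial value. -/
def flowCoeff (a : CoeffSeq T) (m : ℕ) (s : ℝ) : ℂ :=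
  coeff m (act (fun w => iterFrom T a.fn w s) X)

lemma flowCoeff_eq (a : CoeffSeq T) (m : ℕ) (s : ℝ) :
    a.flowCoeff m s = coeff m (returnSeries fun w => iterFrom T a.fn w s) := by
  rw [flowCoeff, act_X rfl]

lemma flowCoeff_zero (a : CoeffSeq T) (m : ℕ) :
    a.flowCoeff m 0 = coeff m (returnSeries a.iterInt) := a.flowCoeff_eq m 0

lemma flowCoeff_end (a : CoeffSeq T) (m : ℕ) : a.flowCoeff m T = if m = 1 then 1 else 0 := by
  have e : (fun w => iterFrom T a.fn w T) = unitSeries := by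
    ext w
    cases w with
    | nil => rfl
    | cons i w => simp [iterFrom, unitSeries]
  rw [flowCoeff, e, act_unit, coeff_X]

/-- For `m ≥ 2` the coefficient of `r^m` is a sum of at most `2^m` terms, and a word of length `k`
contributes at most `C^m (mT)^k / k! ≤ C^m e^{mT}`. Hence `B = 2 C e^T`. The same `B` bounds the
`aᵢ`, so one radius serves the equation and its flow. -/
lemma exists_flowCoeff_le (hT : 0 ≤ T) (a : CoeffSeq T) :
    ∃ B : ℝ, 1 ≤ B ∧ (∀ i x, ‖a.fn i x‖ ≤ B ^ (i : ℕ)) ∧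
      ∀ m, ∀ s ∈ Icc 0 T, ‖a.flowCoeff m s‖ ≤ B ^ m := by
  obtain ⟨C, hC1, hC⟩ := a.exists_norm_le_pow
  have hE : 1 ≤ Real.exp T := Real.one_le_exp hT
  have hCB : C ≤ 2 * C * Real.exp T := by nlinarith
  refine ⟨2 * C * Real.exp T, hC1.trans hCB, fun i x => (hC i x).trans
    (pow_le_pow_left₀ (by linarith) hCB _), fun m s hs => ?_⟩
  have hB1 : (1 : ℝ) ≤ 2 * C * Real.exp T := hC1.trans hCB
  rw [flowCoeff_eq]
  match m with
  | 0 => simp [returnSeries]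
  | 1 => simpa [returnSeries] using hB1
  | m + 2 =>
    simp only [returnSeries, coeff_mk]
    have hterm : ∀ w ∈ words (m + 1), ‖returnPoly w ((m + 1 : ℕ) : ℂ) * iterFrom T a.fn w s‖
        ≤ C ^ (m + 1) * Real.exp T ^ (m + 2) := by
      intro w hw
      rw [mem_words] at hw
      have e : ((m + 1 : ℕ) : ℂ) = ((m + 2 : ℕ) : ℂ) - 1 := by push_cast; ring
      have h1 := norm_returnPoly_le w (m + 2) (by omega)
      have h2 := a.norm_iterFrom_le (fun i => C ^ (i : ℕ)) w (fun i _ => hC i) s hs.2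
      have h3 : (w.map fun i : ℕ+ => C ^ (i : ℕ)).prod = C ^ (m + 1) := by
        rw [← hw]
        clear * -
        induction w with
        | nil => simp [weight_nil]
        | cons i w ih => rw [List.map_cons, List.prod_cons, ih, weight_cons, pow_add]
      rw [h3] at h2
      have h4 : (T - s) ^ w.length ≤ T ^ w.length :=
        pow_le_pow_left₀ (by linarith [hs.2]) (by linarith [hs.1]) _
      have h5 := Real.pow_div_factorial_le_exp (((m + 2 : ℕ) : ℝ) * T) (by positivity) w.length
      rw [Real.exp_nat_mul] at h5
      rw [norm_mul, e]
      calc _ ≤ ((m + 2 : ℕ) : ℝ) ^ w.length *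
            (C ^ (m + 1) * (T ^ w.length / w.length.factorial)) := by
            refine mul_le_mul h1 (h2.trans ?_) (norm_nonneg _) (by positivity)
            gcongr
        _ = C ^ (m + 1) * ((((m + 2 : ℕ) : ℝ) * T) ^ w.length / w.length.factorial) := by
            rw [mul_pow]; ring
        _ ≤ _ := by gcongr
    calc _ ≤ ∑ w ∈ words (m + 1), C ^ (m + 1) * Real.exp T ^ (m + 2) :=
          norm_sum_le_of_le _ hterm
      _ = (words (m + 1)).card * (C ^ (m + 1) * Real.exp T ^ (m + 2)) := by
          rw [Finset.sum_const, nsmul_eq_mul]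
      _ ≤ 2 ^ (m + 2) * (C ^ (m + 2) * Real.exp T ^ (m + 2)) := by
          have h6 : ((words (m + 1)).card : ℝ) ≤ 2 ^ (m + 2) := by
            calc ((words (m + 1)).card : ℝ) ≤ 2 ^ (m + 1) := by exact_mod_cast card_words_le _
              _ ≤ _ := pow_le_pow_right₀ (by norm_num) (by omega)
          have h7 : C ^ (m + 1) ≤ C ^ (m + 2) := pow_le_pow_right₀ hC1 (by omega)
          gcongr
      _ = _ := by rw [mul_pow, mul_pow]; ring

/-- This is the transport equation at `r^m`. The system is triangular: only coefficients of index
below `m` appear on the right. -/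
lemma hasDerivAt_flowCoeff (a : CoeffSeq T) (s : ℝ)
    (hs : ∀ w, HasDerivAt (iterFrom T a.fn w) (a.iterDeriv s w) s) (m : ℕ) :
    HasDerivAt (a.flowCoeff m) (-∑ j ∈ Finset.range m,
      a.fn j.succPNat s * (((m - 1 - j : ℕ) : ℂ) * a.flowCoeff (m - 1 - j) s)) s := by
  have h := a.hasDerivAt_coeff_act s hs X m
  rwa [coeff_vec_mul] at h

lemma ac_flowCoeff (a : CoeffSeq T) (m : ℕ) :
    AbsolutelyContinuousOnInterval (a.flowCoeff m) 0 T := a.ac_coeff_act X m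

end CoeffSeq

/-! ### Solutions with small initial values -/

namespace CoeffSeq

variable {T : ℝ}

lemma hasSum_coeff_nat {a : CoeffSeq T} {x : ℝ} {z s : ℂ}
    (h : HasSum (fun i : ℕ+ => a.fn i x * z ^ ((i : ℕ) + 1)) s) :
    HasSum (fun j : ℕ => a.fn j.succPNat x * z ^ (j + 2)) s :=
  (Equiv.pnatEquivNat.symm.hasSum_iff).2 h

/-- The tail is dominated by `ρ (Bρ)^{n+1}` times a geometric series of ratio `1/2`. The case `n =
0` bounds the whole right-hand side of the equation. -/
lemma norm_tail_le {a : CoeffSeq T} {B ρ : ℝ} (hB : 0 ≤ B) (hρ : B * ρ ≤ 1 / 2)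
    (ha : ∀ i x, ‖a.fn i x‖ ≤ B ^ (i : ℕ)) {x : ℝ} {z s : ℂ} (hz : ‖z‖ ≤ ρ)
    (h : HasSum (fun i : ℕ+ => a.fn i x * z ^ ((i : ℕ) + 1)) s) (n : ℕ) :
    ‖s - ∑ j ∈ Finset.range n, a.fn j.succPNat x * z ^ (j + 2)‖
      ≤ 2 * ρ * (B * ρ) ^ (n + 1) := by
  have hρ0 : 0 ≤ ρ := (norm_nonneg _).trans hz
  have h1 := (hasSum_nat_add_iff' n).2 (hasSum_coeff_nat h)
  have h2 : HasSum (fun j : ℕ => ρ * (B * ρ) ^ (n + 1) * (1 / 2) ^ j)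
      (ρ * (B * ρ) ^ (n + 1) * 2) := hasSum_geometric_two.mul_left _
  refine (h1.norm_le_of_bounded h2 fun j => ?_).trans (le_of_eq (by ring))
  rw [norm_mul, norm_pow]
  have h3 : (B * ρ) ^ j ≤ (1 / 2) ^ j := pow_le_pow_left₀ (by positivity) hρ _
  calc _ ≤ B ^ (j + n + 1) * ρ ^ (j + n + 2) := by
        gcongr
        exact (ha _ _).trans (le_of_eq (by rw [Nat.succPNat_coe]))
    _ = ρ * (B * ρ) ^ (n + 1) * (B * ρ) ^ j := by rw [mul_pow, mul_pow]; ring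
    _ ≤ _ := by gcongr

end CoeffSeq

namespace IsSolution

variable {T : ℝ} {a : CoeffSeq T} {v : ℝ → ℂ}

lemma ae_hasDerivAt (hv : IsSolution a v) : ∀ᵐ x : ℝ, x ∈ Icc 0 T → ∃ s : ℂ,
    HasSum (fun i : ℕ+ => a.fn i x * v x ^ ((i : ℕ) + 1)) s ∧ HasDerivAt v s x :=
  (ae_restrict_iff' measurableSet_Icc).1 hv.2

lemma absolutelyContinuous (hT : 0 ≤ T) (hv : IsSolution a v) :
    AbsolutelyContinuousOnInterval v 0 T := by
  obtain ⟨K, hK⟩ := hv.1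
  rw [← uIcc_of_le hT] at hK
  exact hK.absolutelyContinuousOnInterval

/-- Continuity argument: before the first time `t` at which `‖v‖` reaches `ρ` the speed is at most
`2ρ · Bρ`, so `‖v t‖ < ρ/4 + ρ/2 < ρ`, a contradiction. -/
lemma norm_le (hT : 0 ≤ T) (hv : IsSolution a v) {B ρ : ℝ} (hB : 0 ≤ B)
    (ha : ∀ i x, ‖a.fn i x‖ ≤ B ^ (i : ℕ)) (hρ : B * ρ ≤ 1 / 2) (hρT : B * ρ * T ≤ 1 / 4)
    (h0 : ‖v 0‖ < ρ / 4) : ∀ x ∈ Icc 0 T, ‖v x‖ ≤ ρ := by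
  have hρ0 : 0 < ρ := by linarith [norm_nonneg (v 0)]
  have hc : ContinuousOn v (Icc 0 T) := by
    obtain ⟨K, hK⟩ := hv.1
    exact hK.continuousOn
  by_contra! hcon
  obtain ⟨x₀, hx₀, hx₀'⟩ := hcon
  have hcl : IsCompact (Icc 0 T ∩ (fun x => ‖v x‖) ⁻¹' Ici ρ) :=
    isCompact_Icc.of_isClosed_subset (hc.norm.preimage_isClosed_of_isClosed isClosed_Icc
      isClosed_Ici) inter_subset_left
  obtain ⟨t, ⟨ht, htρ⟩, hmin⟩ := hcl.exists_isLeast ⟨x₀, hx₀, hx₀'.le⟩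
  have htρ : ρ ≤ ‖v t‖ := htρ
  have hlt : ∀ x ∈ Icc 0 T, x < t → ‖v x‖ ≤ ρ := by
    intro x hx hxt
    by_contra! h
    exact absurd (hmin ⟨hx, h.le⟩) (not_le.2 hxt)
  have h1 : ‖v t - v 0‖ ≤ (2 * ρ * (B * ρ)) * (t - 0) := by
    refine norm_sub_le_of_ae_hasDerivAt (F' := deriv v) ht.1 (by positivity)
      ((hv.absolutelyContinuous hT).mono ?_) ?_
    · rw [uIcc_of_le hT, uIcc_of_le ht.1]
      exact Icc_subset_Icc_right ht.2
    -- The bound by `ρ` is available only strictly before `t`; the point `t` is dropped as a null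
    -- set.
    · filter_upwards [hv.ae_hasDerivAt, Measure.ae_ne volume t] with x hx hxt hxm
      obtain ⟨s, hs, hd⟩ := hx ⟨hxm.1, hxm.2.trans ht.2⟩
      rw [hd.deriv]
      refine ⟨hd, ?_⟩
      have := CoeffSeq.norm_tail_le hB hρ ha
        (hlt x ⟨hxm.1, hxm.2.trans ht.2⟩ (lt_of_le_of_ne hxm.2 hxt)) hs 0
      simpa using this
  have h2 : 2 * ρ * (B * ρ) * (t - 0) ≤ ρ / 2 := by
    have : B * ρ * t ≤ 1 / 4 := le_trans (by gcongr; exact ht.2) hρT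
    nlinarith
  have h3 := norm_sub_norm_le (v t) (v 0)
  linarith

-- Let `ψ` be the truncation of `h(x, v(x))` at degree `N`. By the transport equation all terms of
-- degree at most `N` in `v` cancel in `ψ'`, once `v'` is expanded by the equation. What remains is
-- a sum of `k hₖ v^{k-1}` times tails of the equation, each summand being at most of order `N
-- (Bρ)^{N+1}`. Integration over `[0, T]` concludes, as `ψ T = v T`.
open CoeffSeq in
lemma norm_sub_sum_le (hT : 0 ≤ T) (hv : IsSolution a v) {B ρ : ℝ} (hB : 0 ≤ B)
    (ha : ∀ i x, ‖a.fn i x‖ ≤ B ^ (i : ℕ))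
    (hh : ∀ m, ∀ s ∈ Icc 0 T, ‖a.flowCoeff m s‖ ≤ B ^ m) (hρ0 : 0 ≤ ρ) (hρ : B * ρ ≤ 1 / 2)
    (hvρ : ∀ x ∈ Icc 0 T, ‖v x‖ ≤ ρ) (N : ℕ) (hN : 1 ≤ N) :
    ‖v T - ∑ m ∈ Finset.range (N + 1), a.flowCoeff m 0 * v 0 ^ m‖
      ≤ 2 * (N + 1) ^ 2 * (1 / 2) ^ (N + 1) * T := by
  set ψ : ℝ → ℂ := fun x => ∑ m ∈ Finset.range (N + 1), a.flowCoeff m x * v x ^ m with hψ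
  have hvac := hv.absolutelyContinuous hT
  have hpow : ∀ m, AbsolutelyContinuousOnInterval (fun x => v x ^ m) 0 T := by
    intro m
    induction m with
    | zero =>
      simp only [pow_zero]
      exact (LipschitzWith.const (1 : ℂ)).lipschitzOnWith |>.absolutelyContinuousOnInterval
    | succ m ih =>
      simp only [pow_succ]
      exact ih.fun_smul (M := ℂ) hvac
  have hac : AbsolutelyContinuousOnInterval ψ 0 T :=
    ac_sum _ _ _ _ fun m _ => (a.ac_flowCoeff m).fun_smul (M := ℂ) (hpow m)
  have hψT : ψ T = v T := by
    simp only [hψ, flowCoeff_end]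
    rw [Finset.sum_eq_single 1]
    · simp
    · intro m _ hm
      simp [hm]
    · intro h
      exact absurd (Finset.mem_range.2 (by omega)) h
  have key : ∀ᵐ x : ℝ, x ∈ Icc 0 T → HasDerivAt ψ (deriv ψ x) x ∧
      ‖deriv ψ x‖ ≤ 2 * (N + 1) ^ 2 * (1 / 2) ^ (N + 1) := by
    filter_upwards [hv.ae_hasDerivAt, a.ae_hasDerivAt_iterFrom] with x hx hx' hxm
    obtain ⟨s, hs, hd⟩ := hx hxm
    have hf := a.hasDerivAt_flowCoeff x (hx' (by rwa [uIcc_of_le hT]))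
    have hder : HasDerivAt ψ (∑ m ∈ Finset.range (N + 1),
        ((-∑ j ∈ Finset.range m, a.fn j.succPNat x *
          (((m - 1 - j : ℕ) : ℂ) * a.flowCoeff (m - 1 - j) x)) * v x ^ m
          + a.flowCoeff m x * (m * v x ^ (m - 1) * s))) x :=
      HasDerivAt.fun_sum fun m _ => (hf m).mul (hd.pow m)
    rw [hder.deriv]
    refine ⟨hder, ?_⟩
    -- Substitute `m = j + k + 1`: the condition `m ≤ N` becomes `j < N - k`, which fixes where the
    -- tail multiplying `hₖ` begins.
    have hflip : ∑ m ∈ Finset.range (N + 1), (∑ j ∈ Finset.range m, a.fn j.succPNat x *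
          (((m - 1 - j : ℕ) : ℂ) * a.flowCoeff (m - 1 - j) x)) * v x ^ m
        = ∑ k ∈ Finset.range (N + 1), ∑ j ∈ Finset.range (N - k), a.fn j.succPNat x *
          ((k : ℂ) * a.flowCoeff k x) * v x ^ (j + k + 1) := by
      rw [Finset.sum_range_succ', Finset.range_zero, Finset.sum_empty, zero_mul, add_zero]
      have := Finset.sum_range_diag_flip N (fun j k => a.fn j.succPNat x *
          ((k : ℂ) * a.flowCoeff k x) * v x ^ (j + k + 1))
      rw [Finset.sum_comm' (t' := Finset.range N) (s' := fun j => Finset.range (N - j))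
        (by intro k j; simp only [Finset.mem_range]; omega), ← this]
      refine Finset.sum_congr rfl fun m _ => ?_
      rw [Finset.sum_mul]
      refine Finset.sum_congr rfl fun j hj => ?_
      have hj := Finset.mem_range.1 hj
      have e1 : m + 1 - 1 - j = m - j := by omega
      have e2 : j + (m - j) + 1 = m + 1 := by omega
      rw [e1, e2]
    have hrem : ∑ m ∈ Finset.range (N + 1),
        ((-∑ j ∈ Finset.range m, a.fn j.succPNat x *
          (((m - 1 - j : ℕ) : ℂ) * a.flowCoeff (m - 1 - j) x)) * v x ^ m
          + a.flowCoeff m x * (m * v x ^ (m - 1) * s))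
        = ∑ k ∈ Finset.range (N + 1), (k : ℂ) * a.flowCoeff k x * v x ^ (k - 1) *
          (s - ∑ j ∈ Finset.range (N - k), a.fn j.succPNat x * v x ^ (j + 2)) := by
      simp only [neg_mul, Finset.sum_add_distrib, Finset.sum_neg_distrib]
      rw [hflip, ← Finset.sum_neg_distrib, ← Finset.sum_add_distrib]
      refine Finset.sum_congr rfl fun k _ => ?_
      cases k with
      | zero => simp
      | succ k =>
        rw [mul_sub, Finset.mul_sum, sub_eq_neg_add]
        congr 1
        · congr 1
          refine Finset.sum_congr rfl fun j _ => ?_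
          simp only [Nat.add_sub_cancel]
          ring
        · ring
    rw [hrem]
    have hterm : ∀ k ∈ Finset.range (N + 1), ‖(k : ℂ) * a.flowCoeff k x * v x ^ (k - 1) *
          (s - ∑ j ∈ Finset.range (N - k), a.fn j.succPNat x * v x ^ (j + 2))‖
        ≤ 2 * (N + 1) * (1 / 2) ^ (N + 1) := by
      intro k hk
      have hk := Finset.mem_range.1 hk
      cases k with
      | zero =>
        simp only [Nat.cast_zero, zero_mul, norm_zero]
        positivity
      | succ k =>
        have h1 := norm_tail_le hB hρ ha (hvρ x hxm) hs (N - (k + 1))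
        have h2 := pow_le_pow_left₀ (norm_nonneg _) (hvρ x hxm) (k + 1 - 1)
        rw [norm_mul, norm_mul, norm_mul, norm_pow, Complex.norm_natCast]
        calc _ ≤ ((k + 1 : ℕ) : ℝ) * B ^ (k + 1) * ρ ^ (k + 1 - 1) *
              (2 * ρ * (B * ρ) ^ (N - (k + 1) + 1)) := by
              gcongr
              exact hh _ x hxm
          _ = 2 * ((k + 1 : ℕ) : ℝ) * (B * ρ) ^ (N + 1) := by
              have e : N + 1 = (k + 1) + (N - (k + 1) + 1) := by omega
              rw [e, pow_add (B * ρ) (k + 1), mul_pow B ρ (k + 1)]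
              simp only [Nat.add_sub_cancel]
              ring
          _ ≤ 2 * (N + 1) * (1 / 2) ^ (N + 1) := by
              have : ((k + 1 : ℕ) : ℝ) ≤ N + 1 := by exact_mod_cast hk.le
              gcongr
    calc _ ≤ ∑ k ∈ Finset.range (N + 1), (2 * (N + 1) * (1 / 2) ^ (N + 1) : ℝ) :=
          norm_sum_le_of_le _ hterm
      _ = _ := by
          rw [Finset.sum_const, Finset.card_range, nsmul_eq_mul]
          push_cast
          ring
  have := norm_sub_le_of_ae_hasDerivAt hT (by positivity) hac key
  rwa [hψT, sub_zero] at this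

lemma tendsto_sum (hT : 0 ≤ T) (a : CoeffSeq T) : ∃ ε > 0, ∀ v : ℝ → ℂ, IsSolution a v →
    ‖v 0‖ < ε → Tendsto (fun N => ∑ m ∈ Finset.range N, a.flowCoeff m 0 * v 0 ^ m) atTop
      (𝓝 (v T)) := by
  obtain ⟨B, hB1, ha, hh⟩ := a.exists_flowCoeff_le hT
  have hB : 0 < B := by linarith
  -- The factor `1 + T` gives both `Bρ ≤ 1/2`, needed for convergence, and `BρT ≤ 1/4`, needed for
  -- the a priori bound.
  set ρ : ℝ := 1 / (4 * B * (1 + T)) with hρd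
  have hBρ : B * ρ * (1 + T) = 1 / 4 := by
    rw [hρd]; field_simp
  have hρ0 : 0 < ρ := by positivity
  have hBρ0 : 0 < B * ρ := by positivity
  have hρ : B * ρ ≤ 1 / 2 := by nlinarith
  have hρT : B * ρ * T ≤ 1 / 4 := by nlinarith
  refine ⟨ρ / 4, by positivity, fun v hv h0 => ?_⟩
  have hvρ := hv.norm_le hT hB.le ha hρ hρT h0
  rw [← tendsto_add_atTop_iff_nat 1]
  have hlim : Tendsto (fun N : ℕ => 2 * ((N : ℝ) + 1) ^ 2 * (1 / 2) ^ (N + 1) * T) atTop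
      (𝓝 0) := by
    have h1 : Tendsto (fun n : ℕ => (n : ℝ) ^ 2 * (1 / 2 : ℝ) ^ n) atTop (𝓝 0) :=
      tendsto_pow_const_mul_const_pow_of_abs_lt_one 2 (by rw [abs_of_pos] <;> norm_num)
    have h2 := (((tendsto_add_atTop_iff_nat 1).2 h1).const_mul 2).mul_const T
    simp only [mul_zero, zero_mul] at h2
    refine h2.congr fun N => ?_
    push_cast
    ring
  rw [tendsto_iff_norm_sub_tendsto_zero]
  refine squeeze_zero' (Eventually.of_forall fun _ => norm_nonneg _) ?_ hlim
  filter_upwards [eventually_ge_atTop 1] with N hN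
  rw [norm_sub_rev]
  exact hv.norm_sub_sum_le hT hB.le ha hh hρ0.le hρ hvρ N hN

end IsSolution

/-! ### Existence of solutions -/

lemma norm_pow_sub_pow_le_mul {ρ : ℝ} {z w : ℂ} (hz : ‖z‖ ≤ ρ) (hw : ‖w‖ ≤ ρ) (n : ℕ) :
    ‖z ^ (n + 1) - w ^ (n + 1)‖ ≤ (n + 1) * ρ ^ n * ‖z - w‖ := by
  have hρ : 0 ≤ ρ := (norm_nonneg _).trans hz
  induction n with
  | zero => simp
  | succ n ih =>
    have e : z ^ (n + 1 + 1) - w ^ (n + 1 + 1)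
        = z ^ (n + 1) * (z - w) + (z ^ (n + 1) - w ^ (n + 1)) * w := by ring
    rw [e]
    refine (norm_add_le _ _).trans ?_
    rw [norm_mul, norm_mul, norm_pow]
    calc _ ≤ ρ ^ (n + 1) * ‖z - w‖ + (n + 1) * ρ ^ n * ‖z - w‖ * ρ := by gcongr
      _ = _ := by push_cast; ring

namespace CoeffSeq

variable {T : ℝ}

/-- The right-hand side of the equation. -/
def field (a : CoeffSeq T) (x : ℝ) (z : ℂ) : ℂ := ∑' j : ℕ, a.fn j.succPNat x * z ^ (j + 2)

section

variable {a : CoeffSeq T} {B ρ : ℝ}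

lemma hasSum_field (hB : 0 ≤ B) (ha : ∀ i x, ‖a.fn i x‖ ≤ B ^ (i : ℕ)) (hρ : B * ρ ≤ 1 / 2)
    (x : ℝ) {z : ℂ} (hz : ‖z‖ ≤ ρ) :
    HasSum (fun j : ℕ => a.fn j.succPNat x * z ^ (j + 2)) (a.field x z) := by
  have hρ0 : 0 ≤ ρ := (norm_nonneg _).trans hz
  refine (Summable.of_norm_bounded (g := fun j : ℕ => ρ * (B * ρ) * (1 / 2) ^ j)
    (summable_geometric_two.mul_left _) fun j => ?_).hasSum
  rw [norm_mul, norm_pow]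
  have h3 : (B * ρ) ^ j ≤ (1 / 2) ^ j := pow_le_pow_left₀ (by positivity) hρ _
  calc _ ≤ B ^ (j + 1) * ρ ^ (j + 2) := by
        gcongr
        exact (ha _ _).trans (le_of_eq (by rw [Nat.succPNat_coe]))
    _ = ρ * (B * ρ) * (B * ρ) ^ j := by rw [mul_pow]; ring
    _ ≤ _ := by gcongr

lemma hasSum_field' (hB : 0 ≤ B) (ha : ∀ i x, ‖a.fn i x‖ ≤ B ^ (i : ℕ)) (hρ : B * ρ ≤ 1 / 2)
    (x : ℝ) {z : ℂ} (hz : ‖z‖ ≤ ρ) :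
    HasSum (fun i : ℕ+ => a.fn i x * z ^ ((i : ℕ) + 1)) (a.field x z) :=
  (Equiv.pnatEquivNat.symm.hasSum_iff).1 (hasSum_field hB ha hρ x hz)

lemma norm_field_le (hB : 0 ≤ B) (ha : ∀ i x, ‖a.fn i x‖ ≤ B ^ (i : ℕ)) (hρ : B * ρ ≤ 1 / 2)
    (x : ℝ) {z : ℂ} (hz : ‖z‖ ≤ ρ) : ‖a.field x z‖ ≤ 2 * ρ * (B * ρ) := by
  simpa using norm_tail_le hB hρ ha hz (hasSum_field' hB ha hρ x hz) 0

/-- Termwise `‖z^{j+2} - w^{j+2}‖ ≤ (j+2) ρ^{j+1} ‖z - w‖`, and `j + 2 ≤ 2^{j+1}`. The comparison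
ratio is therefore `2Bρ`, whence the hypothesis `Bρ ≤ 1/4`. -/
lemma norm_field_sub_le (hB : 0 ≤ B) (ha : ∀ i x, ‖a.fn i x‖ ≤ B ^ (i : ℕ))
    (hρ : B * ρ ≤ 1 / 4) (x : ℝ) {z w : ℂ} (hz : ‖z‖ ≤ ρ) (hw : ‖w‖ ≤ ρ) :
    ‖a.field x z - a.field x w‖ ≤ 4 * (B * ρ) * ‖z - w‖ := by
  have hρ0 : 0 ≤ ρ := (norm_nonneg _).trans hz
  have h1 := (hasSum_field hB ha (by linarith) x hz).sub
    (hasSum_field hB ha (by linarith) x hw)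
  have h2 : HasSum (fun j : ℕ => 2 * (B * ρ) * ‖z - w‖ * (1 / 2) ^ j)
      (2 * (B * ρ) * ‖z - w‖ * 2) := hasSum_geometric_two.mul_left _
  refine (h1.norm_le_of_bounded h2 fun j => ?_).trans (le_of_eq (by ring))
  rw [← mul_sub, norm_mul]
  have h3 : (2 * (B * ρ)) ^ j ≤ (1 / 2) ^ j :=
    pow_le_pow_left₀ (by positivity) (by linarith) _
  have h4 : ((j + 1 : ℕ) : ℝ) + 1 ≤ 2 ^ (j + 1) := by
    exact_mod_cast Nat.lt_two_pow_self
  calc _ ≤ B ^ (j + 1) * ((((j + 1 : ℕ) : ℝ) + 1) * ρ ^ (j + 1) * ‖z - w‖) := by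
        gcongr
        · exact (ha _ _).trans (le_of_eq (by rw [Nat.succPNat_coe]))
        · exact norm_pow_sub_pow_le_mul hz hw (j + 1)
    _ ≤ B ^ (j + 1) * (2 ^ (j + 1) * ρ ^ (j + 1) * ‖z - w‖) := by gcongr
    _ = 2 * (B * ρ) * ‖z - w‖ * (2 * (B * ρ)) ^ j := by
        rw [mul_pow, mul_pow]; ring
    _ ≤ _ := by gcongr

lemma measurable_field (hB : 0 ≤ B) (ha : ∀ i x, ‖a.fn i x‖ ≤ B ^ (i : ℕ))
    (hρ : B * ρ ≤ 1 / 2) {V : ℝ → ℂ} (hV : Measurable V) (hVρ : ∀ x, ‖V x‖ ≤ ρ) :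
    Measurable fun x => a.field x (V x) := by
  refine measurable_of_tendsto_metrizable (f := fun (n : ℕ) x =>
    ∑ j ∈ Finset.range n, a.fn j.succPNat x * V x ^ (j + 2)) (fun n => ?_)
    (tendsto_pi_nhds.2 fun x => (hasSum_field hB ha hρ x (hVρ x)).tendsto_sum_nat)
  exact Finset.measurable_fun_sum _ fun j _ => (a.measurable_coeff _).mul (hV.pow_const _)

lemma intervalIntegrable_field (hB : 0 ≤ B) (ha : ∀ i x, ‖a.fn i x‖ ≤ B ^ (i : ℕ))
    (hρ : B * ρ ≤ 1 / 2) {V : ℝ → ℂ} (hV : Measurable V) (hVρ : ∀ x, ‖V x‖ ≤ ρ) (s t : ℝ) :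
    IntervalIntegrable (fun x => a.field x (V x)) volume s t :=
  (intervalIntegrable_const (c := 2 * ρ * (B * ρ))).mono_fun'
    (measurable_field hB ha hρ hV hVρ).aestronglyMeasurable
    (Eventually.of_forall fun x => norm_field_le hB ha hρ x (hVρ x))

lemma lipschitz_integral_field (hB : 0 ≤ B) (ha : ∀ i x, ‖a.fn i x‖ ≤ B ^ (i : ℕ))
    (hρ : B * ρ ≤ 1 / 2) (hρ0 : 0 ≤ ρ) {V : ℝ → ℂ} (hV : Measurable V)
    (hVρ : ∀ x, ‖V x‖ ≤ ρ) (r : ℂ) :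
    LipschitzWith (2 * ρ * (B * ρ)).toNNReal
      fun x => r + ∫ u in (0 : ℝ)..x, a.field u (V u) := by
  have hint := intervalIntegrable_field hB ha hρ hV hVρ
  refine LipschitzWith.of_dist_le_mul fun x y => ?_
  rw [Real.coe_toNNReal _ (by positivity), dist_add_left, dist_eq_norm, dist_comm, Real.dist_eq,
    ← norm_neg, neg_sub, intervalIntegral.integral_interval_sub_left (hint _ _) (hint _ _)]
  exact intervalIntegral.norm_integral_le_of_norm_le_const fun u _ =>
    norm_field_le hB ha hρ u (hVρ u)

end

/-- Solutions exist for small initial values. -/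
lemma exists_isSolution (hT : 0 < T) (a : CoeffSeq T) :
    ∃ ε > 0, ∀ r : ℂ, ‖r‖ < ε → ∃ v, IsSolution a v ∧ v 0 = r := by
  obtain ⟨B, hB1, ha⟩ := a.exists_norm_le_pow
  have hB : 0 < B := by linarith
  -- Since `BρT ≤ 1/8`, the integral operator has Lipschitz constant `4BρT ≤ 1/2`, and it preserves
  -- the ball of radius `ρ` because `ρ/2 + ρ/4 ≤ ρ`.
  set ρ : ℝ := 1 / (8 * B * (1 + T)) with hρd
  have hBρ : B * ρ * (1 + T) = 1 / 8 := by
    rw [hρd]; field_simp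
  have hρ0 : 0 < ρ := by positivity
  have hBρ0 : 0 < B * ρ := by positivity
  have hρ4 : B * ρ ≤ 1 / 4 := by nlinarith
  have hρ : B * ρ ≤ 1 / 2 := by linarith
  have hρT : B * ρ * T ≤ 1 / 8 := by nlinarith
  refine ⟨ρ / 2, by positivity, fun r hr => ?_⟩
  let M : Set C(Icc 0 T, ℂ) := {v | ∀ x, ‖v x‖ ≤ ρ}
  have hMc : IsClosed M := by
    have : M = ⋂ x, {v | ‖v x‖ ≤ ρ} := by ext; simp [M]
    rw [this]
    exact isClosed_iInter fun x =>
      isClosed_le (continuous_norm.comp (continuous_eval_const x))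
        continuous_const
  have : CompleteSpace M := hMc.completeSpace_coe
  have hne : Nonempty M := ⟨⟨0, fun x => by simpa using hρ0.le⟩⟩
  -- Constant extension beyond `[0, T]` keeps the bound `ρ` on the whole line, so the primitive
  -- below is globally Lipschitz.
  let V : M → ℝ → ℂ := fun v x => v.1 (projIcc 0 T hT.le x)
  have hVc : ∀ v, Continuous (V v) := fun v => v.1.continuous.comp continuous_projIcc
  have hVm : ∀ v, Measurable (V v) := fun v => (hVc v).measurable
  have hVρ : ∀ v x, ‖V v x‖ ≤ ρ := fun v x => v.2 _
  let S : M → ℝ → ℂ := fun v x => r + ∫ u in (0 : ℝ)..x, a.field u (V v u)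
  have hSl : ∀ v, LipschitzWith (2 * ρ * (B * ρ)).toNNReal (S v) := fun v =>
    lipschitz_integral_field hB.le ha hρ hρ0.le (hVm v) (hVρ v) r
  have hSρ : ∀ v, ∀ x ∈ Icc 0 T, ‖S v x‖ ≤ ρ := by
    intro v x hx
    have h1 : ‖∫ u in (0 : ℝ)..x, a.field u (V v u)‖ ≤ 2 * ρ * (B * ρ) * |x - 0| :=
      intervalIntegral.norm_integral_le_of_norm_le_const fun u _ =>
        norm_field_le hB.le ha hρ u (hVρ v u)
    rw [sub_zero, abs_of_nonneg hx.1] at h1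
    have h2 : B * ρ * x ≤ 1 / 8 := le_trans (by gcongr; exact hx.2) hρT
    have h3 := norm_add_le r (∫ u in (0 : ℝ)..x, a.field u (V v u))
    change ‖r + _‖ ≤ ρ
    nlinarith
  let Φ : M → M := fun v => ⟨⟨fun x => S v x, (hSl v).continuous.comp continuous_subtype_val⟩,
    fun x => hSρ v x x.2⟩
  have hΦ : ContractingWith (1 / 2) Φ := by
    refine ⟨by norm_num, LipschitzWith.of_dist_le_mul fun v w => ?_⟩
    change dist (Φ v).1 (Φ w).1 ≤ _ * dist v.1 w.1
    refine (ContinuousMap.dist_le (by positivity)).2 fun x => ?_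
    have hd : ∀ u, ‖a.field u (V v u) - a.field u (V w u)‖
        ≤ 4 * (B * ρ) * dist v.1 w.1 := by
      intro u
      refine (norm_field_sub_le hB.le ha hρ4 u (hVρ v u) (hVρ w u)).trans ?_
      gcongr
      rw [← dist_eq_norm]
      exact ContinuousMap.dist_apply_le_dist _
    have e : (Φ v).1 x - (Φ w).1 x
        = ∫ u in (0 : ℝ)..x, (a.field u (V v u) - a.field u (V w u)) := by
      rw [intervalIntegral.integral_sub
        (intervalIntegrable_field hB.le ha hρ (hVm v) (hVρ v) _ _)
        (intervalIntegrable_field hB.le ha hρ (hVm w) (hVρ w) _ _)]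
      exact add_sub_add_left_eq_sub _ _ _
    rw [dist_eq_norm, e]
    refine (intervalIntegral.norm_integral_le_of_norm_le_const fun u _ => hd u).trans ?_
    rw [sub_zero, abs_of_nonneg x.2.1]
    have h2 : B * ρ * x ≤ 1 / 8 := le_trans (by gcongr; exact x.2.2) hρT
    have h3 := dist_nonneg (x := v.1) (y := w.1)
    push_cast
    nlinarith
  obtain ⟨v, hv⟩ : ∃ v, Φ v = v := ⟨hΦ.fixedPoint Φ, hΦ.fixedPoint_isFixedPt⟩
  have hSV : ∀ x ∈ Icc 0 T, S v x = V v x := by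
    intro x hx
    have h1 : (Φ v).1 ⟨x, hx⟩ = v.1 ⟨x, hx⟩ := by rw [hv]
    simp only [V, projIcc_of_mem hT.le hx]
    exact h1
  refine ⟨S v, ⟨⟨_, (hSl v).lipschitzOnWith⟩, ?_⟩, by simp [S]⟩
  rw [ae_restrict_iff' measurableSet_Icc]
  filter_upwards [(intervalIntegrable_field hB.le ha hρ (hVm v) (hVρ v)
    0 T).ae_hasDerivAt_integral] with x hx hxm
  have h1 := (hx (by rwa [uIcc_of_le hT.le]) 0 left_mem_uIcc).const_add r
  rw [← hSV x hxm] at h1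
  exact ⟨_, hasSum_field' hB.le ha hρ x (hSρ v x hxm), h1⟩

end CoeffSeq

/-! ### Centers and the first return map -/

/-- The growth bound turns convergence of partial sums into absolute convergence near `0`. Thus `e`
is a power series expansion of the zero function, and such an expansion is unique. -/
lemma eq_zero_of_tendsto_sum {e : ℕ → ℂ} {K B ε : ℝ} (hB : 0 < B) (hε : 0 < ε)
    (he : ∀ m, ‖e m‖ ≤ K * B ^ m)
    (h : ∀ z : ℂ, ‖z‖ < ε →
      Tendsto (fun N => ∑ m ∈ Finset.range N, e m * z ^ m) atTop (𝓝 0)) : e = 0 := by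
  have hp : HasFPowerSeriesAt (0 : ℂ → ℂ) (FormalMultilinearSeries.ofScalars ℂ e) 0 := by
    rw [hasFPowerSeriesAt_iff]
    have hev : ∀ᶠ z : ℂ in 𝓝 0, ‖z‖ < min ε (1 / (2 * B)) :=
      (continuous_norm.tendsto (0 : ℂ)).eventually_lt_const (by
        rw [norm_zero]; positivity)
    filter_upwards [hev] with z hz
    have hz1 := hz.trans_le (min_le_left _ _)
    have hz2 : B * ‖z‖ ≤ 1 / 2 := by
      have := (hz.trans_le (min_le_right _ _)).le
      rw [le_div_iff₀ (by positivity)] at this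
      linarith
    have hs : Summable fun m => e m * z ^ m := by
      refine Summable.of_norm_bounded (g := fun m : ℕ => K * (1 / 2) ^ m)
        (summable_geometric_two.mul_left _) fun m => ?_
      have hK : 0 ≤ K := by simpa using (norm_nonneg _).trans (he 0)
      rw [norm_mul, norm_pow]
      calc _ ≤ K * B ^ m * ‖z‖ ^ m := by gcongr; exact he m
        _ = K * (B * ‖z‖) ^ m := by rw [mul_pow]; ring
        _ ≤ _ := by gcongr
    have h0 := tendsto_nhds_unique hs.hasSum.tendsto_sum_nat (h z hz1)
    have h1 := hs.hasSum
    rw [h0] at h1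
    simpa [FormalMultilinearSeries.coeff_ofScalars, mul_comm] using h1
  have h0 := hp.eq_zero
  ext m
  have h1 := congrArg (fun p => FormalMultilinearSeries.coeff p m) h0
  rw [FormalMultilinearSeries.coeff_ofScalars] at h1
  exact h1

open CoeffSeq in
/-- A sequence is a center exactly when its first return map is the identity. -/
lemma mem_centers_iff {T : ℝ} (hT : 0 < T) (a : CoeffSeq T) :
    a ∈ centers T ↔ returnSeries a.iterInt = PowerSeries.X := by
  obtain ⟨ε₁, hε₁, h₁⟩ := IsSolution.tendsto_sum hT.le a
  constructor
  · rintro ⟨ε₂, hε₂, h₂⟩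
    obtain ⟨ε₃, hε₃, h₃⟩ := a.exists_isSolution hT
    obtain ⟨B, hB1, -, hB⟩ := a.exists_flowCoeff_le hT.le
    -- The definition of a center quantifies over solutions, so it carries information only because
    -- each small `z` is the initial value of one. For that solution `v T` equals both `z` and the
    -- sum of the flow series at `z`.
    have key : (fun m => a.flowCoeff m 0 - if m = 1 then 1 else 0) = 0 := by
      refine eq_zero_of_tendsto_sum (K := 2) (B := B) (ε := min ε₁ (min ε₂ ε₃)) (by linarith)
        (by positivity) (fun m => ?_) fun z hz => ?_
      · have h1 := hB m 0 ⟨le_refl _, hT.le⟩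
        have h2 : ‖(if m = 1 then 1 else 0 : ℂ)‖ ≤ B ^ m := by
          split_ifs
          · simpa using one_le_pow₀ hB1
          · simp only [norm_zero]
            positivity
        linarith [norm_sub_le (a.flowCoeff m 0) (if m = 1 then 1 else 0)]
      · obtain ⟨v, hv, hv0⟩ := h₃ z (hz.trans_le ((min_le_right _ _).trans (min_le_right _ _)))
        have h4 := h₁ v hv (by rw [hv0]; exact hz.trans_le (min_le_left _ _))
        rw [h₂ v hv (by rw [hv0]; exact hz.trans_le ((min_le_right _ _).trans (min_le_left _ _))),
          hv0] at h4
        have h5 := h4.sub_const z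
        rw [sub_self] at h5
        refine h5.congr' ?_
        filter_upwards [eventually_ge_atTop 2] with N hN
        simp only [sub_mul, Finset.sum_sub_distrib]
        congr 1
        rw [Finset.sum_eq_single 1]
        · simp
        · intro m _ hm
          simp [hm]
        · intro h
          exact absurd (Finset.mem_range.2 (by omega)) h
    ext m
    rw [PowerSeries.coeff_X, ← flowCoeff_zero]
    exact sub_eq_zero.1 (congrFun key m)
  · intro h
    refine ⟨ε₁, hε₁, fun v hv h0 => ?_⟩
    refine tendsto_nhds_unique (h₁ v hv h0) (tendsto_const_nhds.congr' ?_)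
    filter_upwards [eventually_ge_atTop 2] with N hN
    simp only [flowCoeff_zero, h, PowerSeries.coeff_X]
    rw [Finset.sum_eq_single 1]
    · simp
    · intro m _ hm
      simp [hm]
    · intro h
      exact absurd (Finset.mem_range.2 (by omega)) h

/-! ### Sequences with a prescribed first return map -/

section Inverse

open PowerSeries

lemma coeff_succ_inv {D : PowerSeries ℂ} (hD : constantCoeff D = 1) (n : ℕ) :
    coeff (n + 1) D⁻¹
      = -∑ j ∈ Finset.range (n + 1), coeff (j + 1) D * coeff (n - j) D⁻¹ := by
  have h := congrArg (coeff (n + 1))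
    (PowerSeries.mul_inv_cancel D (by rw [hD]; exact one_ne_zero))
  rw [coeff_mul, Finset.Nat.sum_antidiagonal_eq_sum_range_succ
    (fun i k => coeff i D * coeff k D⁻¹), Finset.sum_range_succ', coeff_one,
    if_neg (Nat.succ_ne_zero n), coeff_zero_eq_constantCoeff_apply, hD, one_mul] at h
  rw [Nat.sub_zero] at h
  simpa only [Nat.add_sub_add_right] using eq_neg_of_add_eq_zero_right h

/-- The recursion for the inverse gives `∑_{j ≤ k} K^{j+1} (2K)^{k-j} = K^{k+1} (2^{k+1} - 1)` as a
bound at index `k + 1`. -/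
lemma norm_coeff_inv_le {D : PowerSeries ℂ} (hD : constantCoeff D = 1) {K : ℝ} (hK : 0 ≤ K)
    (n : ℕ) (h : ∀ j, 1 ≤ j → j ≤ n → ‖coeff j D‖ ≤ K ^ j) :
    ∀ k ≤ n, ‖coeff k D⁻¹‖ ≤ (2 * K) ^ k := by
  intro k
  induction k using Nat.strong_induction_on with
  | _ k ih =>
    intro hk
    cases k with
    | zero => simp [hD]
    | succ k =>
      rw [coeff_succ_inv hD, norm_neg]
      have hterm : ∀ j ∈ Finset.range (k + 1), ‖coeff (j + 1) D * coeff (k - j) D⁻¹‖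
          ≤ K ^ (k + 1) * 2 ^ (k + 1 - 1 - j) := by
        intro j hj
        have hj := Finset.mem_range.1 hj
        rw [norm_mul]
        calc _ ≤ K ^ (j + 1) * (2 * K) ^ (k - j) := by
              gcongr
              · exact h _ (by omega) (by omega)
              · exact ih _ (by omega) (by omega)
          _ = _ := by
              have e : k + 1 = (j + 1) + (k - j) := by omega
              rw [mul_pow, Nat.add_sub_cancel, e, pow_add]
              ring
      refine (norm_sum_le_of_le _ hterm).trans ?_
      rw [← Finset.mul_sum, Finset.sum_range_reflect (fun j => (2 : ℝ) ^ j), mul_pow, mul_comm]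
      gcongr
      rw [geom_sum_eq (by norm_num)]
      norm_num

lemma continuous_coeff_inv {D : ℝ → PowerSeries ℂ} (hD : ∀ s, constantCoeff (D s) = 1)
    (hc : ∀ n, Continuous fun s => coeff n (D s)) (n : ℕ) :
    Continuous fun s => coeff n (D s)⁻¹ := by
  induction n using Nat.strong_induction_on with
  | _ n ih =>
    cases n with
    | zero => simpa [hD] using continuous_const
    | succ n =>
      simp only [coeff_succ_inv (hD _)]
      exact (continuous_finsetSum _ fun j _ => (hc _).mul (ih _ (by omega))).neg

lemma constantCoeff_one_add_C_mul {g : PowerSeries ℂ} (hg1 : coeff 1 g = 0) (l : ℂ) :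
    constantCoeff (1 + C l * derivative ℂ g) = 1 := by
  have h : constantCoeff (derivative ℂ g) = 0 := by
    rw [← coeff_zero_eq_constantCoeff_apply, coeff_derivative, hg1, zero_mul]
  simp [h]

/-- This serves two purposes. With `δ = 1` it shows that the generator is geometrically bounded and
so lies in `X`. With `K = 1` and `δ` small it shows that the generator is small; linearity in `δ`
comes from the factor `g` outside the inverse. -/
lemma norm_coeff_mul_inv_le {g : PowerSeries ℂ} (hg0 : coeff 0 g = 0) (hg1 : coeff 1 g = 0)
    {l : ℂ} (hl : ‖l‖ ≤ 1) {K δ : ℝ} (hK : 1 ≤ K) (hδ0 : 0 ≤ δ) (hδ : δ ≤ 1) (n : ℕ)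
    (h : ∀ j ≤ n, ‖coeff j g‖ ≤ δ * K ^ j) :
    ‖coeff n (g * (1 + C l * derivative ℂ g)⁻¹)‖ ≤ δ * (8 * K ^ 2) ^ n := by
  set D : PowerSeries ℂ := 1 + C l * derivative ℂ g with hDdef
  have hD : constantCoeff D = 1 := constantCoeff_one_add_C_mul hg1 l
  -- Coefficient `j` of `D` involves coefficient `j + 1` of `g`, hence the range `j ≤ n - 1`. It
  -- suffices, since `g` has no constant term and the inverse enters only up to index `n - 1`. The
  -- condition `1 ≤ j` is what gives `K^{j+1} ≤ K^{2j}`.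
  have hDn : ∀ j, 1 ≤ j → j ≤ n - 1 → ‖coeff j D‖ ≤ (2 * K ^ 2) ^ j := by
    intro j hj hjn
    have e : coeff j D = l * (coeff (j + 1) g * (j + 1)) := by
      rw [hDdef, map_add, coeff_one, if_neg (by omega), zero_add, coeff_C_mul, coeff_derivative]
    have h1 : ‖(j : ℂ) + 1‖ = (j : ℝ) + 1 := by
      rw [← Nat.cast_succ, Complex.norm_natCast, Nat.cast_succ]
    have h2 : (j : ℝ) + 1 ≤ 2 ^ j := by exact_mod_cast Nat.lt_two_pow_self
    rw [e, norm_mul, norm_mul, h1]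
    calc _ ≤ 1 * (δ * K ^ (j + 1) * 2 ^ j) := by
          gcongr
          exact h _ (by omega)
      _ ≤ 1 * (1 * K ^ (2 * j) * 2 ^ j) := by
          gcongr
          omega
      _ = _ := by rw [mul_pow, pow_mul]; ring
  have hI := norm_coeff_inv_le hD (by positivity) (n - 1) hDn
  rw [coeff_mul]
  have hterm : ∀ p ∈ Finset.HasAntidiagonal.antidiagonal n,
      ‖coeff p.1 g * coeff p.2 D⁻¹‖ ≤ δ * (4 * K ^ 2) ^ n := by
    rintro ⟨p, q⟩ hp
    rw [Finset.HasAntidiagonal.mem_antidiagonal] at hp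
    have hp : p + q = n := hp
    cases p with
    | zero =>
      simp only [hg0, zero_mul, norm_zero]
      positivity
    | succ p =>
      rw [norm_mul]
      have hK2 : K ≤ 4 * K ^ 2 := by nlinarith
      calc _ ≤ δ * K ^ (p + 1) * (2 * (2 * K ^ 2)) ^ q := by
            gcongr
            · exact h _ (by omega)
            · exact hI _ (by omega)
        _ ≤ δ * (4 * K ^ 2) ^ (p + 1) * (2 * (2 * K ^ 2)) ^ q := by gcongr
        _ = _ := by
            rw [← hp, pow_add]
            ring
  refine (norm_sum_le_of_le _ hterm).trans ?_
  rw [Finset.sum_const, Finset.Nat.card_antidiagonal, nsmul_eq_mul]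
  have h2 : ((n + 1 : ℕ) : ℝ) ≤ 2 ^ n := by exact_mod_cast Nat.lt_two_pow_self
  calc _ ≤ 2 ^ n * (δ * (4 * K ^ 2) ^ n) := by gcongr
    _ = δ * (2 * (4 * K ^ 2)) ^ n := by rw [mul_pow 2 (4 * K ^ 2)]; ring
    _ = _ := by ring

end Inverse

/-! ### Flows along the straight line from the identity to a given series. -/

namespace CoeffSeq

open PowerSeries

variable {T : ℝ}

/-- The parameter of the linear path from the identity to a given series. -/
def param (T s : ℝ) : ℂ := ((T - s) / T : ℝ)

lemma norm_param_le {s : ℝ} (hs : s ∈ Icc 0 T) : ‖param T s‖ ≤ 1 := by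
  rw [param, Complex.norm_real, Real.norm_eq_abs, abs_le]
  have hT : 0 ≤ T := hs.1.trans hs.2
  constructor
  · exact le_trans (by norm_num) (div_nonneg (sub_nonneg.2 hs.2) hT)
  · exact div_le_one_of_le₀ (by linarith [hs.1]) hT

lemma continuous_param : Continuous (param T) := by
  unfold param
  fun_prop

lemma hasDerivAt_param (s : ℝ) : HasDerivAt (param T) (-(T : ℂ)⁻¹) s := by
  have h : HasDerivAt (fun s : ℝ => (T - s) / T) (-1 / T) s :=
    ((hasDerivAt_id s).const_sub T).div_const T
  have e : ((-1 / T : ℝ) : ℂ) = -(T : ℂ)⁻¹ := by push_cast; ring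
  rw [← e]
  exact h.ofReal_comp

/-- The generator of the linear path `X + param T s • g`. -/
def generator (T : ℝ) (g : PowerSeries ℂ) (s : ℝ) : PowerSeries ℂ :=
  C (T : ℂ)⁻¹ * (g * (1 + C (param T s) * derivative ℂ g)⁻¹)

lemma continuous_coeff_generator {g : PowerSeries ℂ} (hg1 : coeff 1 g = 0) (n : ℕ) :
    Continuous fun s => coeff n (generator T g s) := by
  have e : ∀ s, coeff n (generator T g s)
      = (T : ℂ)⁻¹ * ∑ p ∈ Finset.HasAntidiagonal.antidiagonal n,
        coeff p.1 g * coeff p.2 (1 + C (param T s) * derivative ℂ g)⁻¹ := by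
    intro s
    rw [generator, coeff_C_mul, coeff_mul]
  simp only [e]
  refine continuous_const.mul (continuous_finsetSum _ fun p _ => continuous_const.mul ?_)
  refine continuous_coeff_inv (fun s => constantCoeff_one_add_C_mul hg1 _) (fun n => ?_) _
  simp only [map_add, coeff_C_mul]
  exact continuous_const.add (continuous_param.mul continuous_const)

lemma norm_coeff_generator_le (hT : 0 < T) {g : PowerSeries ℂ} (hg0 : coeff 0 g = 0)
    (hg1 : coeff 1 g = 0) {s : ℝ} (hs : s ∈ Icc 0 T) {K δ : ℝ} (hK : 1 ≤ K) (hδ0 : 0 ≤ δ)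
    (hδ : δ ≤ 1) (n : ℕ) (h : ∀ j ≤ n, ‖coeff j g‖ ≤ δ * K ^ j) :
    ‖coeff n (generator T g s)‖ ≤ T⁻¹ * (δ * (8 * K ^ 2) ^ n) := by
  rw [generator, coeff_C_mul, norm_mul, norm_inv, Complex.norm_real, Real.norm_of_nonneg hT.le]
  gcongr
  exact norm_coeff_mul_inv_le hg0 hg1 (norm_param_le hs) hK hδ0 hδ n h

/-- The sequence whose flow from time `s` to time `T` is `X + param T s • g`. -/
def ofGenerator (hT : 0 < T) (g : PowerSeries ℂ) (hg0 : coeff 0 g = 0) (hg1 : coeff 1 g = 0)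
    (hg : ∃ K : ℝ, 1 ≤ K ∧ ∀ j, ‖coeff j g‖ ≤ K ^ j) : CoeffSeq T where
  fn i := (Icc 0 T).indicator fun s => coeff (i + 1) (generator T g s)
  measurable_coeff i := (continuous_coeff_generator hg1 _).measurable.indicator measurableSet_Icc
  support_coeff i x hx := indicator_of_notMem hx _
  bound_coeff := by
    obtain ⟨K, hK, h⟩ := hg
    -- The outer square absorbs the shift between `i` and `i + 1`: for `i ≥ 1`, `(8K²)^{i+1} ≤
    -- (8K²)^{2i}`.
    refine ⟨(1 + T⁻¹) * (8 * K ^ 2) ^ 2, fun i x => ?_⟩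
    have hT' : 0 < T⁻¹ := inv_pos.2 hT
    have h8 : 1 ≤ 8 * K ^ 2 := by nlinarith
    have hi : 1 ≤ (i : ℕ) := i.pos
    have hle : ‖(Icc 0 T).indicator (fun s => coeff (i + 1) (generator T g s)) x‖
        ≤ ((1 + T⁻¹) * (8 * K ^ 2) ^ 2) ^ (i : ℕ) := by
      by_cases hx : x ∈ Icc 0 T
      · rw [indicator_of_mem hx]
        refine (norm_coeff_generator_le hT hg0 hg1 hx hK zero_le_one le_rfl _
          fun j _ => by simpa using h j).trans ?_
        rw [one_mul, mul_pow (1 + T⁻¹), ← pow_mul (8 * K ^ 2)]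
        have h1 : T⁻¹ ≤ (1 + T⁻¹) ^ (i : ℕ) :=
          (by linarith : T⁻¹ ≤ 1 + T⁻¹).trans (le_self_pow₀ (by linarith) (by omega))
        have h2 : (8 * K ^ 2) ^ ((i : ℕ) + 1) ≤ (8 * K ^ 2) ^ (2 * (i : ℕ)) :=
          pow_le_pow_right₀ h8 (by omega)
        gcongr
      · rw [indicator_of_notMem hx, norm_zero]
        positivity
    calc _ ≤ (((1 + T⁻¹) * (8 * K ^ 2) ^ 2) ^ (i : ℕ)) ^ ((i : ℝ)⁻¹) :=
          Real.rpow_le_rpow (norm_nonneg _) hle (by positivity)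
      _ = _ := Real.pow_rpow_inv_natCast (by positivity) i.ne_zero

section

variable {hT : 0 < T} {g : PowerSeries ℂ} {hg0 : coeff 0 g = 0} {hg1 : coeff 1 g = 0}
  {hg : ∃ K : ℝ, 1 ≤ K ∧ ∀ j, ‖coeff j g‖ ≤ K ^ j}

/-- Since `λ' = -T⁻¹`, this is the transport equation for the line `r + λ(s) g`. The generator has
no terms below `r²` because `g` has none, so nothing is lost in reading it as a right-hand side of
the equation. -/
lemma vec_ofGenerator {s : ℝ} (hs : s ∈ Icc 0 T) :
    (ofGenerator hT g hg0 hg1 hg).vec s * (X * derivative ℂ (X + C (param T s) * g))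
      = C (T : ℂ)⁻¹ * g := by
  have h1 : (ofGenerator hT g hg0 hg1 hg).vec s * X = generator T g s := by
    ext n
    have hc0 : coeff 0 (generator T g s) = 0 := by
      rw [generator, coeff_C_mul, coeff_mul]
      simp [hg0]
    have hc1 : coeff 1 (generator T g s) = 0 := by
      rw [generator, coeff_C_mul, coeff_mul]
      simp [Finset.Nat.antidiagonal_succ, hg0, hg1]
    match n with
    | 0 => rw [hc0]; simp
    | 1 =>
      rw [hc1, ← zero_add 1, coeff_succ_mul_X]
      simp [vec]
    | n + 2 =>
      rw [coeff_succ_mul_X]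
      simp [vec, ofGenerator, indicator_of_mem hs]
  have h2 : derivative ℂ (X + C (param T s) * g) = 1 + C (param T s) * derivative ℂ g := by
    rw [map_add, derivative_X, Derivation.leibniz, derivative_C]
    simp
  rw [← mul_assoc, h1, h2, generator, mul_assoc, mul_assoc,
    PowerSeries.inv_mul_cancel _ (by rw [constantCoeff_one_add_C_mul hg1]; exact one_ne_zero),
    mul_one]

/-- The flow and the line obey the same triangular system and both equal `r` at `s = T`. Once the
lower coefficients agree, the difference of the `m`-th ones has derivative zero almost everywhere,
hence is constant, and it vanishes at `T`. -/
lemma flowCoeff_ofGenerator (m : ℕ) : ∀ s ∈ Icc 0 T,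
    (ofGenerator hT g hg0 hg1 hg).flowCoeff m s = coeff m (X + C (param T s) * g) := by
  set a := ofGenerator hT g hg0 hg1 hg with ha
  induction m using Nat.strong_induction_on with
  | _ m ih =>
    have hac : AbsolutelyContinuousOnInterval
        (fun s => a.flowCoeff m s - coeff m (X + C (param T s) * g)) 0 T := by
      refine (a.ac_flowCoeff m).fun_sub ?_
      simp only [map_add, coeff_C_mul, param]
      have hd : ContDiff ℝ 1 fun s : ℝ =>
          coeff m (X : PowerSeries ℂ) + (((T - s) / T : ℝ) : ℂ) * coeff m g := by
        refine contDiff_const.add (ContDiff.mul ?_ contDiff_const)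
        exact Complex.ofRealCLM.contDiff.comp
          ((contDiff_const.sub contDiff_id).div_const T)
      exact hd.contDiffOn.absolutelyContinuousOnInterval
    obtain ⟨c, hc⟩ := hac.const_of_ae_hasDerivAt_zero (by
      filter_upwards [a.ae_hasDerivAt_iterFrom] with s hs hsm
      have h1 := a.hasDerivAt_flowCoeff s (hs hsm) m
      have h2 : HasDerivAt (fun s => coeff m (X + C (param T s) * g))
          (-(T : ℂ)⁻¹ * coeff m g) s := by
        simp only [map_add, coeff_C_mul]
        exact ((hasDerivAt_param s).mul_const _).const_add _
      have hsI : s ∈ Icc 0 T := by rwa [uIcc_of_le hT.le] at hsm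
      have h3 : (T : ℂ)⁻¹ * coeff m g = ∑ j ∈ Finset.range m,
          a.fn j.succPNat s * (((m - 1 - j : ℕ) : ℂ) * a.flowCoeff (m - 1 - j) s) := by
        rw [← coeff_C_mul, ← vec_ofGenerator (hT := hT) (hg0 := hg0) (hg1 := hg1) (hg := hg) hsI,
          coeff_vec_mul]
        refine Finset.sum_congr rfl fun j hj => ?_
        have hj := Finset.mem_range.1 hj
        rw [ih _ (by omega) s hsI]
      have h4 := h1.sub h2
      rwa [← h3, neg_mul, sub_self] at h4)
    intro s hs
    rw [uIcc_of_le hT.le] at hc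
    have hend := hc T ⟨hT.le, le_rfl⟩
    have hp : param T T = 0 := by simp [param]
    rw [flowCoeff_end, hp, map_zero, zero_mul, add_zero, coeff_X, sub_self] at hend
    exact sub_eq_zero.1 ((hc s hs).trans hend.symm)

lemma returnSeries_ofGenerator :
    returnSeries (ofGenerator hT g hg0 hg1 hg).iterInt = X + g := by
  ext m
  have hp : param T 0 = 1 := by simp [param, hT.ne']
  rw [← flowCoeff_zero, flowCoeff_ofGenerator m 0 ⟨le_rfl, hT.le⟩, hp, map_one, one_mul]

lemma norm_ofGenerator_le {δ : ℝ} (hδ0 : 0 ≤ δ) (hδ : δ ≤ 1) (i : ℕ+)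
    (h : ∀ j ≤ (i : ℕ) + 1, ‖coeff j g‖ ≤ δ) (x : ℝ) :
    ‖(ofGenerator hT g hg0 hg1 hg).fn i x‖ ≤ T⁻¹ * 8 ^ ((i : ℕ) + 1) * δ := by
  by_cases hx : x ∈ Icc 0 T
  · simp only [ofGenerator, indicator_of_mem hx]
    refine (norm_coeff_generator_le hT hg0 hg1 hx le_rfl hδ0 hδ _
      fun j hj => by simpa using h j hj).trans (le_of_eq ?_)
    ring
  · simp only [ofGenerator, indicator_of_notMem hx, norm_zero]
    have : 0 < T⁻¹ := inv_pos.2 hT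
    positivity

end

end CoeffSeq

/-! ### Density of the centers -/

namespace CoeffSeq

open PowerSeries

variable {T : ℝ}

lemma coeff_zero_returnSeries_sub (f : List ℕ+ → ℂ) : coeff 0 (returnSeries f - X) = 0 := by
  simp [returnSeries]

lemma coeff_one_returnSeries_sub (f : List ℕ+ → ℂ) : coeff 1 (returnSeries f - X) = 0 := by
  simp [returnSeries]

lemma exists_coeff_returnSeries_sub_le (hT : 0 < T) (a : CoeffSeq T) :
    ∃ K : ℝ, 1 ≤ K ∧ ∀ j, ‖coeff j (returnSeries a.iterInt - X)‖ ≤ K ^ j := by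
  obtain ⟨B, hB1, -, hB⟩ := a.exists_flowCoeff_le hT.le
  refine ⟨B, hB1, fun j => ?_⟩
  by_cases hj : j = 1
  · rw [hj, coeff_one_returnSeries_sub, norm_zero]
    positivity
  · rw [map_sub, coeff_X, if_neg hj, sub_zero, ← flowCoeff_zero]
    exact hB j 0 ⟨le_rfl, hT.le⟩

/-- A sequence with the same first return map as `a⁻¹`, small if this map is close to the
identity. -/
def correction (hT : 0 < T) (a : CoeffSeq T) : CoeffSeq T :=
  ofGenerator hT (returnSeries a.inv.iterInt - X) (coeff_zero_returnSeries_sub _)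
    (coeff_one_returnSeries_sub _) (a.inv.exists_coeff_returnSeries_sub_le hT)

lemma returnSeries_correction (hT : 0 < T) (a : CoeffSeq T) :
    returnSeries (a.correction hT).iterInt = returnSeries a.inv.iterInt := by
  rw [correction, returnSeries_ofGenerator, add_sub_cancel]

/-- A fixed word has letters bounded by its weight, so its iterated integral feels only finitely
many coefficients of the return series. Coefficientwise convergence is therefore enough. -/
lemma tendsto_iterInt_correction (hT : 0 < T) {l : Filter (CoeffSeq T)}
    (hl : ∀ j, Tendsto (fun a : CoeffSeq T => coeff j (returnSeries a.inv.iterInt - X)) l (𝓝 0)) :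
    Tendsto (fun a => (a.correction hT).iterInt) l (𝓝 unitSeries) := by
  refine tendsto_pi_nhds.2 fun w => ?_
  cases w with
  | nil => exact tendsto_const_nhds
  | cons i w =>
    -- A letter `k` uses coefficients of index at most `k + 1`, hence at most the weight plus one.
    let δ : CoeffSeq T → ℝ := fun a => ∑ j ∈ Finset.range (weight (i :: w) + 2),
      ‖coeff j (returnSeries a.inv.iterInt - X)‖
    have hδ : Tendsto δ l (𝓝 0) := by
      have := tendsto_finsetSum (Finset.range (weight (i :: w) + 2)) fun j _ => (hl j).norm
      simpa only [norm_zero, Finset.sum_const_zero] using this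
    have hδ0 : ∀ a, 0 ≤ δ a := fun a => Finset.sum_nonneg fun _ _ => norm_nonneg _
    let Q : ℝ → ℝ := fun d => ((i :: w).map fun k : ℕ+ => T⁻¹ * 8 ^ ((k : ℕ) + 1) * d).prod *
      ((T - 0) ^ (i :: w).length / (i :: w).length.factorial)
    have hQ : Continuous Q :=
      (continuous_list_prod _ fun k _ => continuous_const.mul continuous_id).mul continuous_const
    -- The word is nonempty, so the product contains a factor `d`.
    have hQ0 : Q 0 = 0 := by simp [Q]
    have hlim : Tendsto (fun a => Q (δ a)) l (𝓝 0) := by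
      have := (hQ.tendsto 0).comp hδ
      rwa [hQ0] at this
    refine squeeze_zero_norm' ?_ hlim
    filter_upwards [hδ.eventually_le_const zero_lt_one] with a ha
    refine norm_iterFrom_le _ (fun k : ℕ+ => T⁻¹ * 8 ^ ((k : ℕ) + 1) * δ a) _
      (fun k hk x => ?_) 0 hT.le
    have hkw : (k : ℕ) ≤ weight (i :: w) :=
      List.single_le_sum (by simp) _ (List.mem_map_of_mem hk)
    refine norm_ofGenerator_le (hδ0 a) ha k (fun j hj => ?_) x
    exact Finset.single_le_sum (f := fun j => ‖coeff j (returnSeries a.inv.iterInt - X)‖)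
      (fun _ _ => norm_nonneg _) (Finset.mem_range.2 (by omega))

end CoeffSeq

namespace FormalPaths

open PowerSeries

variable {T : ℝ} [hT : Fact (0 < T)]

lemma mem_formalCenters_iff (g : FormalPaths T) :
    g ∈ formalCenters T ↔ returnSeries (iterInt g) = X :=
  MonoidHom.mem_ker.trans FormalDiffeo.ext_iff

lemma ofPathHom_toPath_mem_iff (a : CoeffSeq T) :
    ofPathHom (toPath a) ∈ formalCenters T ↔ returnSeries a.iterInt = X := by
  have e : iterInt (ofPathHom (toPath a)) = a.iterInt := iterInt_ofPath (toPath a)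
  rw [mem_formalCenters_iff, e]

lemma continuous_coeff_returnSeries (j : ℕ) :
    Continuous fun g : FormalPaths T => coeff j (returnSeries (iterInt g)) := by
  have e : ∀ g : FormalPaths T, returnSeries (iterInt g) = act (iterInt g) X :=
    fun g => (act_X (iterInt_nil g)).symm
  simp only [e, coeff_act]
  exact continuous_finsetSum _ fun n _ => continuous_const.mul
    (continuous_finsetSum _ fun w _ => continuous_const.mul
      ((continuous_apply w).comp continuous_iterInt))

/-- With `c` the correction, `P̂(a * c) = P̂(a) P̂(c) = P̂(a) P̂(a⁻¹) = 1`. -/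
lemma mul_correction_mem (a : CoeffSeq T) :
    ofPathHom (toPath (a.mul (a.correction hT.out))) ∈ formalCenters T := by
  have h : returnMap (ofPathHom (toPath (a.correction hT.out)))
      = returnMap (ofPathHom (toPath a.inv)) := by
    refine FormalDiffeo.ext ?_
    have e : ∀ b : CoeffSeq T, (returnMap (ofPathHom (toPath b))).series
        = returnSeries b.iterInt :=
      fun b => congrArg returnSeries (iterInt_ofPath (toPath b))
    rw [e, e, CoeffSeq.returnSeries_correction]
  have h2 : toPath a.inv = (toPath a)⁻¹ := rfl
  rw [formalCenters, MonoidHom.mem_ker, PathGroup.toPath_mul, map_mul, map_mul, h, h2, map_inv,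
    map_inv, mul_inv_cancel]

/-- As the class of `a` tends to `g`, continuity of inversion makes `P̂(a⁻¹)` tend to `P̂(g⁻¹) = r`.
The correction then tends to the identity, so multiplying by it moves `a` into the kernel without
changing the limit. -/
lemma mem_closure_centers {g : FormalPaths T} (hg : g ∈ formalCenters T) :
    g ∈ closure (ofPathHom '' ((formalCenters T).comap ofPathHom : Set (PathGroup T))) := by
  have hq : Function.Surjective (toPath : CoeffSeq T → PathGroup T) := Quotient.mk_surjective
  have hd : DenseRange fun a : CoeffSeq T => ofPathHom (toPath a) :=
    isDenseInducing_ofPath.dense.comp hq.denseRange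
      isDenseInducing_ofPath.continuous
  -- The neighbourhood filter of `g` is pulled back to representatives in `X`, on which the
  -- correction is defined; it is nontrivial by density of `G(X)`.
  let l : Filter (CoeffSeq T) := comap (fun a => ofPathHom (toPath a)) (𝓝 g)
  have : l.NeBot := comap_neBot_iff.2 fun t ht => by
    obtain ⟨a, ha⟩ := hd.mem_nhds ht
    exact ⟨a, ha⟩
  have hlg : Tendsto (fun a : CoeffSeq T => ofPathHom (toPath a)) l (𝓝 g) := tendsto_comap
  have hinv : ∀ j, Tendsto
      (fun a : CoeffSeq T => coeff j (returnSeries a.inv.iterInt - X)) l (𝓝 0) := by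
    intro j
    have h1 := ((continuous_coeff_returnSeries j).tendsto g⁻¹).comp hlg.inv
    rw [(mem_formalCenters_iff _).1 (inv_mem hg)] at h1
    have h2 := h1.sub_const (coeff j X)
    rw [sub_self] at h2
    refine h2.congr fun a => ?_
    have e : iterInt (ofPathHom (toPath a))⁻¹ = a.inv.iterInt := by
      rw [← map_inv]
      exact iterInt_ofPath (toPath a)⁻¹
    rw [map_sub, Function.comp_apply, e]
  refine mem_closure_of_tendsto (b := l)
    (f := fun a => ofPathHom (toPath (a.mul (a.correction hT.out)))) ?_
    (Eventually.of_forall fun a => ⟨_, mul_correction_mem a, rfl⟩)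
  rw [isUniformInducing_iterInt.isInducing.tendsto_nhds_iff]
  have e : iterInt ∘ (fun a : CoeffSeq T => ofPathHom (toPath (a.mul (a.correction hT.out))))
      = fun a => conv (a.correction hT.out).iterInt a.iterInt := by
    ext1 a
    rw [← CoeffSeq.iterInt_mul hT.out]
    exact iterInt_ofPath _
  have h1 : Tendsto (fun a : CoeffSeq T => a.iterInt) l (𝓝 (iterInt g)) :=
    ((continuous_iterInt.tendsto g).comp hlg).congr fun a => iterInt_ofPath (toPath a)
  rw [e, ← unit_conv (iterInt g)]
  exact (continuous_conv.tendsto (unitSeries, iterInt g)).comp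
    ((CoeffSeq.tendsto_iterInt_correction hT.out hinv).prodMk_nhds h1)

end FormalPaths

end CenterProblem

end

/-! ### The centers as the trace of the formal centers on the group of paths. -/

theorem proposition3p6 (T : ℝ) [Fact (0 < T)] :
    ∃ H : Subgroup (CenterProblem.PathGroup T),
      (H : Set (CenterProblem.PathGroup T)) =
        CenterProblem.toPath '' CenterProblem.centers T ∧
      H.map CenterProblem.FormalPaths.ofPathHom ≤ CenterProblem.formalCenters T ∧
      Dense (((H.map CenterProblem.FormalPaths.ofPathHom).subgroupOf
        (CenterProblem.formalCenters T) : Subgroup (CenterProblem.formalCenters T)) :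
          Set (CenterProblem.formalCenters T)) := by
  have hT : 0 < T := Fact.out
  -- Taking the preimage of `Ker P̂` makes the subgroup property and the inclusion automatic. That
  -- it equals `π(C)` is `mem_centers_iff`: the return series depends only on the class, so every
  -- representative of a class in the preimage is a center.
  refine ⟨(CenterProblem.formalCenters T).comap CenterProblem.FormalPaths.ofPathHom, ?_,
    Subgroup.map_comap_le _ _, ?_⟩
  · ext g
    constructor
    · intro hg
      induction g using Quotient.inductionOn with
      | _ a =>
        exact ⟨a, (CenterProblem.mem_centers_iff hT a).2
          ((CenterProblem.FormalPaths.ofPathHom_toPath_mem_iff a).1 hg), rfl⟩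
    · rintro ⟨a, ha, rfl⟩
      exact (CenterProblem.FormalPaths.ofPathHom_toPath_mem_iff a).2
        ((CenterProblem.mem_centers_iff hT a).1 ha)
  · refine Subtype.dense_iff.2 fun g hg => ?_
    have h := CenterProblem.FormalPaths.mem_closure_centers hg
    refine closure_mono ?_ h
    rintro _ ⟨p, hp, rfl⟩
    exact ⟨⟨_, hp⟩, ⟨p, hp, rfl⟩, rfl⟩
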